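/- Conventions. Let $U,V$ be subgroups of a finite group $G$ (or closed subgroups of a profinite group $G$). They are called \emph{Sylow-conjugate} in $G$ if, for every prime $p$, the $p$-Sylow subgroups of $U$ and of $V$ are conjugate in $G$; if $G$ is finite, they are called \emph{Gassmann equivalent} if $|C\cap U|=|C\cap V|$ for every conjugacy class $C$ of $G$. Two number fields $K,L$ are called Sylow-conjugate if, after embedding them in $\overline{\mathbb Q}$, the subgroups $\mathrm{Gal}(\overline{\mathbb Q}/K)$ and $\mathrm{Gal}(\overline{\mathbb Q}/L)$ are Sylow-conjugate in $\mathrm{Gal}(\overline{\mathbb Q}/\mathbb Q)$ (this does not depend on the embeddings), and arithmetically equivalent if their Dedekind zeta functions are equal. Let $F=\mathbb F_q$ be a finite field, let $d\ge 3$, and let $G=\mathrm{PSL}_d(q)$. Let $U\le G$ be the stabilizer of a $1$-dimensional subspace of $F^d$, and let $V\le G$ be the stabilizer of a hyperplane (a $(d-1)$-dimensional subspace) of $F^d$. Then: (1) $U$ and $V$ are maximal subgroups of $G$; they are Sylow-conjugate in $G$, not conjugate in $G$, but $\varphi(U)=V$ for some automorphism $\varphi$ of $G$ that is not inner; and they are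 Gassmann equivalent in $G$. (2) Let $M/\mathbb Q$ be a finite Galois extension with an isomorphism $\mathrm{Gal}(M/\mathbb Q)\cong G$, by which $U$ and $V$ are viewed as subgroups of $\mathrm{Gal}(M/\mathbb Q)$. Then the fixed fields $K=M^U$ and $L=M^V$ are number fields that are Sylow-conjugate and arithmetically equivalent, but not isomorphic. (3) There is a finite Galois extension $M/\mathbb Q$ with $\mathrm{Gal}(M/\mathbb Q)\cong \mathrm{PSL}_3(2)$, so that (2) yields such pairs of number fields. -/

import Mathlib

open scoped NumberField

/-- Two subgroups of `G` are conjugate in `G`. -/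
def SubgroupsConjugate {G : Type*} [Group G] (U V : Subgroup G) : Prop :=
  ∃ g : G, U.map (MulAut.conj g).toMonoidHom = V

/-- Sylow-conjugacy of subgroups of a finite group: for every prime `p`, the `p`-Sylow subgroups
of `U` and of `V` are conjugate in `G`. (Since all `p`-Sylow subgroups of a finite group are
conjugate in it, it does not matter which ones are taken.) -/
def SylowConjugate {G : Type*} [Group G] (U V : Subgroup G) : Prop :=
  ∀ p : ℕ, p.Prime → ∃ (P : Sylow p U) (Q : Sylow p V),
    SubgroupsConjugate ((P : Subgroup U).map U.subtype) ((Q : Subgroup V).map V.subtype)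

/-- Gassmann equivalence: `|C ∩ U| = |C ∩ V|` for every conjugacy class `C` of `G`. -/
def GassmannEquivalent {G : Type*} [Group G] (U V : Subgroup G) : Prop :=
  ∀ C : ConjClasses G, (C.carrier ∩ (U : Set G)).ncard = (C.carrier ∩ (V : Set G)).ncard

/-- `P` is a `p`-Sylow subgroup of the profinite group `H`: it is closed, pro-`p`, and of
(supernatural) index prime to `p`. The last two conditions are read off in the finite quotients
`H ⧸ N` by open normal subgroups `N`. -/
def IsProfiniteSylow (p : ℕ) {H : Type*} [Group H] [TopologicalSpace H] (P : Subgroup H) : Prop :=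
  IsClosed (P : Set H) ∧
    ∀ (N : Subgroup H) [N.Normal], IsOpen (N : Set H) →
      IsPGroup p (P.map (QuotientGroup.mk' N)) ∧ ¬ p ∣ (P.map (QuotientGroup.mk' N)).index

/-- Sylow-conjugacy of closed subgroups of a profinite group. (Again, all `p`-Sylow subgroups of
a profinite group are conjugate in it, so that the choice does not matter.) -/
def ProfiniteSylowConjugate {G : Type*} [Group G] [TopologicalSpace G] (U V : Subgroup G) : Prop :=
  ∀ p : ℕ, p.Prime → ∃ (P : Subgroup U) (Q : Subgroup V),
    IsProfiniteSylow p P ∧ IsProfiniteSylow p Q ∧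
      SubgroupsConjugate (P.map U.subtype) (Q.map V.subtype)

/-- Two number fields are Sylow-conjugate if their absolute Galois groups, as subgroups of
`Gal(ℚ̄/ℚ)`, are Sylow-conjugate. A number field is placed inside `ℚ̄` by an embedding; changing
the embedding replaces the absolute Galois group by a conjugate. -/
def NumberField.SylowConjugate (K L : Type*) [Field K] [NumberField K] [Field L]
    [NumberField L] : Prop :=
  ∀ (σ : K →ₐ[ℚ] AlgebraicClosure ℚ) (τ : L →ₐ[ℚ] AlgebraicClosure ℚ),
    ProfiniteSylowConjugate σ.fieldRange.fixingSubgroup τ.fieldRange.fixingSubgroup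

/-- Two number fields are arithmetically equivalent if their Dedekind zeta functions agree. -/
def NumberField.ArithmeticallyEquivalent (K L : Type*) [Field K] [NumberField K] [Field L]
    [NumberField L] : Prop :=
  NumberField.dedekindZeta K = NumberField.dedekindZeta L

/-- The stabilizer in `SL_d(F)` of a subspace of `F^d`. -/
def slStabilizer {d : ℕ} {F : Type*} [Field F] (W : Submodule F (Fin d → F)) :
    Subgroup (Matrix.SpecialLinearGroup (Fin d) F) where
  carrier := {A | W.map (Matrix.SpecialLinearGroup.toLin' A).toLinearMap = W}
  one_mem' := by
    simp only [Set.mem_ofPred_eq, map_one]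
    exact Submodule.map_id W
  mul_mem' := by
    intro A B hA hB
    simp only [Set.mem_ofPred_eq] at hA hB ⊢
    rw [map_mul]
    change W.map ((Matrix.SpecialLinearGroup.toLin' A).toLinearMap ∘ₗ
      (Matrix.SpecialLinearGroup.toLin' B).toLinearMap) = W
    rw [Submodule.map_comp, hB, hA]
  inv_mem' := by
    intro A hA
    simp only [Set.mem_ofPred_eq] at hA ⊢
    have h : (Matrix.SpecialLinearGroup.toLin' A⁻¹).toLinearMap ∘ₗ
        (Matrix.SpecialLinearGroup.toLin' A).toLinearMap = LinearMap.id := by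
      change (Matrix.SpecialLinearGroup.toLin' A⁻¹ *
        Matrix.SpecialLinearGroup.toLin' A).toLinearMap = LinearMap.id
      rw [← map_mul, inv_mul_cancel, map_one]
      rfl
    conv_lhs => rw [← hA]
    rw [← Submodule.map_comp, h, Submodule.map_id]

/-- The stabilizer in `PSL_d(F)` of a subspace of `F^d`. As the centre of `SL_d(F)` consists of
scalar matrices, which preserve every subspace, it is the image of the stabilizer in `SL_d(F)`. -/
def pslStabilizer {d : ℕ} {F : Type*} [Field F] (W : Submodule F (Fin d → F)) :
    Subgroup (Matrix.ProjectiveSpecialLinearGroup (Fin d) F) :=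
  (slStabilizer W).map (QuotientGroup.mk' (Subgroup.center _))

/-!
The automorphism `A ↦ (Aᵀ)⁻¹` of `SL_d(F)` exchanges the stabilizers of lines and hyperplanes. An
element of `SL_d(F)` fixes as many lines as hyperplanes, because `A` and `Aᵀ` have eigenspaces of
the same dimensions; this is Gassmann equivalence. For Sylow-conjugacy, a `p`-Sylow subgroup of the
stabilizer of a line has to fix some hyperplane. If `p` is the characteristic of `F`, then a
`p`-group acting on a non-zero vector space over `F` fixes a non-zero vector. Otherwise one averages
a linear form that does not vanish on the line. The stabilizers are maximal since `SL_d(F)` acts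
doubly transitively on the lines, and not conjugate since the stabilizer of a line fixes no
hyperplane when `d ≥ 3`.

Sylow-conjugacy passes to absolute Galois groups because the `p`-Sylow subgroups of a profinite
group map onto those of its finite quotients. As for the zeta functions, Gassmann equivalence
provides equally many homomorphisms `𝓞 K → 𝔽̄_p` and `𝓞 L → 𝔽̄_p` fixed by each power of the
Frobenius, hence equally many primes, and then equally many ideals, of each norm.

For `PSL_3(2)`, a factor of degree 7 of the resolvent for sums of three roots of Trinks' polynomial
`X ^ 7 - 7 X + 3` puts the structure of a Fano plane on the roots, so that the Galois group embeds
into `SL_3(2)`. It contains an element of order 7 and an involution, complex conjugation, and such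
a pair generates `SL_3(2)`.
-/

section Fano

open Matrix
open scoped Finset MatrixGroups Pointwise

namespace Fano

local instance : Fact (Nat.Prime 7) := ⟨by norm_num⟩

theorem eq_zero_or_eq_one : ∀ z : ZMod 2, z = 0 ∨ z = 1 := by
  decide

/-- A Singer cycle of `𝔽₂³`: multiplication by a root `α` of `X ^ 3 + X + 1` on
`𝔽₂[α] = 𝔽₈`, in the basis `1, α, α ^ 2`. -/
def singer : SL(3, ZMod 2) := ⟨!![0, 0, 1; 1, 0, 1; 0, 1, 0], by decide⟩

/-- The transvections of `𝔽₂³` with centre spanned by the first basis vector (together with the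
identity, which is `elation 0 0`). -/
def elation (a b : ZMod 2) : SL(3, ZMod 2) :=
  ⟨!![1, a, b; 0, 1, 0; 0, 0, 1], by revert a b; decide⟩

theorem exists_singer_conj_involution_eq_elation :
    ∀ τ : SL(3, ZMod 2), τ * τ = 1 → τ ≠ 1 →
      ∃ (n : Fin 7) (a b : ZMod 2), (a ≠ 0 ∨ b ≠ 0) ∧
        singer ^ (n : ℕ) * τ = elation a b * singer ^ (n : ℕ) := by
  decide +kernel

theorem exists_singer_conj_transvection_eq_elation :
    ∀ i j : Fin 3, ∀ hij : i ≠ j, ∃ (n : Fin 7) (a b : ZMod 2),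
      singer ^ (n : ℕ) * SpecialLinearGroup.transvection hij (1 : ZMod 2) =
        elation a b * singer ^ (n : ℕ) := by
  decide +kernel

theorem elation_mem {I : Subgroup SL(3, ZMod 2)} (hs : singer ∈ I) {x y : ZMod 2}
    (hxy : x ≠ 0 ∨ y ≠ 0) (h : elation x y ∈ I) (a b : ZMod 2) : elation a b ∈ I := by
  have sq_mem (m : ℕ) {T : SL(3, ZMod 2)} (hT : T ∈ I) :
      (singer ^ (7 - m) * T * singer ^ m * T) ^ 2 ∈ I :=
    I.pow_mem (I.mul_mem (I.mul_mem (I.mul_mem (I.pow_mem hs _) hT) (I.pow_mem hs _)) hT) _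
  have h₁ (h : elation 0 1 ∈ I) : elation 1 0 ∈ I := by
    convert sq_mem 1 h using 1; decide +kernel
  have h₂ (h : elation 1 0 ∈ I) : elation 1 1 ∈ I := by
    convert sq_mem 2 h using 1; decide +kernel
  have h₄ (h : elation 1 1 ∈ I) : elation 0 1 ∈ I := by
    convert sq_mem 4 h using 1; decide +kernel
  have h₀ : elation 0 0 ∈ I := by
    convert I.one_mem using 1; decide +kernel
  have elation_zero_one_mem : elation 0 1 ∈ I := by
    obtain rfl | rfl := eq_zero_or_eq_one x <;> obtain rfl | rfl := eq_zero_or_eq_one y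
    · simp at hxy
    · exact h
    · exact h₄ (h₂ h)
    · exact h₄ h
  obtain rfl | rfl := eq_zero_or_eq_one a <;> obtain rfl | rfl := eq_zero_or_eq_one b
  · exact h₀
  · exact elation_zero_one_mem
  · exact h₁ elation_zero_one_mem
  · exact h₂ (h₁ elation_zero_one_mem)

theorem eq_top_of_forall_transvection_mem {n : Type*} [Fintype n] [DecidableEq n]
    {I : Subgroup (SpecialLinearGroup n (ZMod 2))}
    (h : ∀ (i j : n) (hij : i ≠ j), SpecialLinearGroup.transvection hij 1 ∈ I) : I = ⊤ := by
  have transvections_prod_mem (L : List (TransvectionStruct n (ZMod 2))) :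
      (L.map TransvectionStruct.toSpecialLinearGroup).prod ∈ I := by
    refine I.list_prod_mem fun A hA ↦ ?_
    obtain ⟨⟨i, j, hij, c⟩, -, rfl⟩ := List.mem_map.1 hA
    obtain rfl | rfl := eq_zero_or_eq_one c
    · simp [I.one_mem]
    · exact h i j hij
  refine I.eq_top_iff'.2 fun A ↦ ?_
  obtain ⟨L, L', D, hD, rfl⟩ :=
    SpecialLinearGroup.exists_list_transvec_mul_diagonal_mul_list_transvec A
  obtain rfl : D = 1 := funext fun i ↦
    (eq_zero_or_eq_one _).resolve_left (SpecialLinearGroup.diagonal_neZero D hD i)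
  have diagonal_eq_one : (⟨diagonal 1, hD⟩ : SpecialLinearGroup n (ZMod 2)) =
      (1 : SpecialLinearGroup n (ZMod 2)) := Subtype.ext diagonal_one
  rw [diagonal_eq_one, mul_one]
  exact I.mul_mem (transvections_prod_mem L) (transvections_prod_mem L')

theorem eq_top_of_singer_mem_of_involution_mem {I : Subgroup SL(3, ZMod 2)} (hs : singer ∈ I)
    {τ : SL(3, ZMod 2)} (hτI : τ ∈ I) (hτ : τ * τ = 1) (hτ1 : τ ≠ 1) : I = ⊤ := by
  obtain ⟨n, x, y, hxy, hn⟩ := exists_singer_conj_involution_eq_elation τ hτ hτ1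
  have hxyI : elation x y ∈ I := by
    rw [← I.mul_mem_cancel_right (I.pow_mem hs n), ← hn]
    exact I.mul_mem (I.pow_mem hs n) hτI
  refine eq_top_of_forall_transvection_mem fun i j hij ↦ ?_
  obtain ⟨n, a, b, hn⟩ := exists_singer_conj_transvection_eq_elation i j hij
  rw [← I.mul_mem_cancel_left (I.pow_mem hs n), hn]
  exact I.mul_mem (elation_mem hs hxy hxyI a b) (I.pow_mem hs n)

/-- The non-zero vectors of `𝔽₂³`, that is, the points of the Fano plane, listed as the powers
of a root of `X ^ 3 + X + 1` in `𝔽₈`. -/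
def point (i : ZMod 7) : Fin 3 → ZMod 2 :=
  ![![1, 0, 0], ![0, 1, 0], ![0, 0, 1], ![1, 1, 0], ![0, 1, 1], ![1, 1, 1], ![1, 0, 1]]
    (i : Fin 7)

/-- The perfect difference set modulo 7 whose translates are the lines of the Fano plane. -/
def diffSet : Finset (ZMod 7) := {0, 1, 3}

/-- The map `t` sends each translate of `D` into a translate of `D`, and its complement into the
complement. For `D = diffSet` these are the collineations of the Fano plane. -/
def PermutesTranslates (D : Finset (ZMod 7)) (t : ZMod 7 → ZMod 7) : Prop :=
  ∀ i, ∃ j, ∀ x, x - i ∈ D ↔ t x - j ∈ D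

theorem point_injective : Function.Injective point := by
  decide

theorem point_add_point_add_one : ∀ i, point i + point (i + 1) = point (i + 3) := by
  decide

theorem point_add_point_of_mem_diffSet : ∀ {i j k : ZMod 7}, i ≠ j → i ≠ k → j ≠ k →
    ∀ {m : ZMod 7}, i - m ∈ diffSet → j - m ∈ diffSet → k - m ∈ diffSet →
      point i + point j = point k := by
  decide +kernel

/-- The matrix sending the first three points to the points `t 0`, `t 1` and `t 2`. -/
def pointMatrix (t : ZMod 7 → ZMod 7) : Matrix (Fin 3) (Fin 3) (ZMod 2) :=
  of fun i j ↦ point (t ((j : ℕ) : ZMod 7)) i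

theorem pointMatrix_id : pointMatrix id = 1 := by
  decide

variable {s t : ZMod 7 → ZMod 7}

theorem pointMatrix_mulVec_point (ht : PermutesTranslates diffSet t)
    (hinj : Function.Injective t) (i : ZMod 7) : pointMatrix t *ᵥ point i = point (t i) := by
  have basis (j : Fin 3) :
      pointMatrix t *ᵥ point ((j : ℕ) : ZMod 7) = point (t ((j : ℕ) : ZMod 7)) := by
    have : point ((j : ℕ) : ZMod 7) = Pi.single j 1 := by revert j; decide
    rw [this, mulVec_single_one]
    rfl
  have recurrence (i : ZMod 7) (h : pointMatrix t *ᵥ point i = point (t i))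
      (h' : pointMatrix t *ᵥ point (i + 1) = point (t (i + 1))) :
      pointMatrix t *ᵥ point (i + 3) = point (t (i + 3)) := by
    have line : ∀ i : ZMod 7, i ≠ i + 1 ∧ i ≠ i + 3 ∧ i + 1 ≠ i + 3 ∧
        i - i ∈ diffSet ∧ i + 1 - i ∈ diffSet ∧ i + 3 - i ∈ diffSet := by decide
    obtain ⟨hij, hik, hjk, hi, hj, hk⟩ := line i
    obtain ⟨m, hm⟩ := ht i
    rw [← point_add_point_add_one, mulVec_add, h, h']
    exact point_add_point_of_mem_diffSet (hinj.ne hij) (hinj.ne hik) (hinj.ne hjk)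
      ((hm _).1 hi) ((hm _).1 hj) ((hm _).1 hk)
  have h₃ := recurrence 0 (basis 0) (basis 1)
  have h₄ := recurrence 1 (basis 1) (basis 2)
  have h₅ := recurrence 2 (basis 2) h₃
  have h₆ := recurrence 3 h₃ h₄
  have cases : ∀ i : ZMod 7, i = 0 ∨ i = 1 ∨ i = 2 ∨ i = 0 + 3 ∨ i = 1 + 3 ∨ i = 2 + 3 ∨
      i = 3 + 3 := by decide
  obtain rfl | rfl | rfl | rfl | rfl | rfl | rfl := cases i
  exacts [basis 0, basis 1, basis 2, h₃, h₄, h₅, h₆]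

theorem pointMatrix_comp (hs : PermutesTranslates diffSet s) (hinj : Function.Injective s) :
    pointMatrix (s ∘ t) = pointMatrix s * pointMatrix t := by
  ext i j
  exact (congrFun (pointMatrix_mulVec_point hs hinj (t ((j : ℕ) : ZMod 7))) i).symm

/-- The linear representation on `𝔽₂³` of a group of collineations of the Fano plane. -/
def collineationRep {H : Type*} [Group H] (ρ : H →* Equiv.Perm (ZMod 7))
    (hρ : ∀ h, PermutesTranslates diffSet (ρ h)) : H →* SL(3, ZMod 2) :=
  have pointMatrix_mul (g h : H) :
      pointMatrix (ρ (g * h)) = pointMatrix (ρ g) * pointMatrix (ρ h) := by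
    rw [map_mul, Equiv.Perm.coe_mul, pointMatrix_comp (hρ g) (ρ g).injective]
  have pointMatrix_one : pointMatrix (ρ 1) = 1 := by
    rw [map_one]
    exact pointMatrix_id
  { toFun h := ⟨pointMatrix (ρ h), (eq_zero_or_eq_one _).resolve_left fun hdet ↦ by
      have := congrArg det (pointMatrix_mul h h⁻¹)
      rw [mul_inv_cancel, pointMatrix_one, det_one, det_mul, hdet, zero_mul] at this
      exact one_ne_zero this⟩
    map_one' := Subtype.ext pointMatrix_one
    map_mul' g h := Subtype.ext (pointMatrix_mul g h) }

theorem collineationRep_injective {H : Type*} [Group H] {ρ : H →* Equiv.Perm (ZMod 7)}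
    (hρ : ∀ h, PermutesTranslates diffSet (ρ h)) (hinj : Function.Injective ρ) :
    Function.Injective (collineationRep ρ hρ) := by
  refine fun g h hgh ↦ hinj (Equiv.ext fun i ↦ point_injective ?_)
  have : pointMatrix (ρ g) = pointMatrix (ρ h) := congrArg Subtype.val hgh
  rw [← pointMatrix_mulVec_point (hρ g) (ρ g).injective, this,
    pointMatrix_mulVec_point (hρ h) (ρ h).injective]

theorem nonempty_mulEquiv_of_permutesTranslates_diffSet {H : Type*} [Group H]
    {ρ : H →* Equiv.Perm (ZMod 7)} (hρ : ∀ h, PermutesTranslates diffSet (ρ h))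
    (hinj : Function.Injective ρ) {s τ : H} (hs : ∀ x, ρ s x = x + 1) (hτ : τ * τ = 1)
    (hτ1 : τ ≠ 1) : Nonempty (H ≃* SL(3, ZMod 2)) := by
  have hrep := collineationRep_injective hρ hinj
  have singer_eq : collineationRep ρ hρ s = singer := by
    have : ⇑(ρ s) = (· + 1) := funext hs
    refine Subtype.ext (?_ : pointMatrix (ρ s) = _)
    rw [this]
    decide
  refine ⟨MulEquiv.ofBijective _ ⟨hrep, MonoidHom.range_eq_top.1 ?_⟩⟩
  refine eq_top_of_singer_mem_of_involution_mem ⟨s, singer_eq⟩ ⟨τ, rfl⟩ ?_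
    ((map_ne_one_iff _ hrep).2 hτ1)
  rw [← map_mul, hτ, map_one]

variable {D : Finset (ZMod 7)}

/-- The number of pairs of elements of `D` whose difference is `d`. -/
def distCount (D : Finset (ZMod 7)) (d : ZMod 7) : ℕ :=
  #{x | x ∈ D ∧ x + d ∈ D}

theorem distCount_sub (D : Finset (ZMod 7)) (a b : ZMod 7) :
    distCount D (b - a) = #{i | a - i ∈ D ∧ b - i ∈ D} := by
  refine Finset.card_equiv (Equiv.subLeft a) fun x ↦ ?_
  rw [Finset.mem_filter_univ, Finset.mem_filter_univ, Equiv.subLeft_apply, sub_sub_cancel,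
    show b - (a - x) = x + (b - a) by ring]

theorem eq_of_translate_eq (hD : #D = 3) {i j : ZMod 7} (h : ∀ x, x - i ∈ D ↔ x - j ∈ D) :
    i = j := by
  have aperiodic : ∀ D ∈ Finset.powersetCard 3 (Finset.univ : Finset (ZMod 7)), ∀ d : ZMod 7,
      (∀ x, x ∈ D ↔ x + d ∈ D) → d = 0 := by decide +kernel
  refine sub_eq_zero.1 (aperiodic D (by simp [hD]) (i - j) fun x ↦ ?_)
  rw [← add_sub_assoc, ← h, add_sub_cancel_right]

theorem PermutesTranslates.distCount_le (hD : #D = 3) {t : ZMod 7 → ZMod 7}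
    (ht : PermutesTranslates D t) (a b : ZMod 7) :
    distCount D (b - a) ≤ distCount D (t b - t a) := by
  rw [distCount_sub, distCount_sub]
  choose π hπ using ht
  refine Finset.card_le_card_of_injOn π (fun i hi ↦ ?_) fun i _ j _ hij ↦ ?_
  · rw [Finset.mem_coe, Finset.mem_filter_univ] at hi ⊢
    exact ⟨(hπ i a).1 hi.1, (hπ i b).1 hi.2⟩
  · exact eq_of_translate_eq hD fun x ↦ by rw [hπ i, hπ j, hij]

theorem affine_equiv_diffSet_or_exists_distCount_eq_two (hD : #D = 3) :
    (∃ k ≠ 0, ∃ c, ∀ x, x ∈ D ↔ k * x + c ∈ diffSet) ∨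
      ∃ k ≠ 0, ∀ d, distCount D d = 2 ↔ d = k ∨ d = -k := by
  have key : ∀ D ∈ Finset.powersetCard 3 (Finset.univ : Finset (ZMod 7)),
      (∃ k ≠ 0, ∃ c, ∀ x, x ∈ D ↔ k * x + c ∈ diffSet) ∨
        ∃ k ≠ 0, ∀ d, distCount D d = 2 ↔ d = k ∨ d = -k := by
    decide +kernel
  exact key D (by simp [hD])

theorem eq_add_mul_of_forall_eq_add_or_sub {p : ℕ} [Fact p.Prime] (hp : p ≠ 2)
    {t : ZMod p → ZMod p} (ht : Function.Injective t) {k : ZMod p} (hk : k ≠ 0)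
    (h : ∀ x, t (x + k) = t x + k ∨ t (x + k) = t x - k) (a : ZMod p) :
    ∃ ε : ZMod p, (ε = 1 ∨ ε = -1) ∧ ∀ x, t x = t a + ε * (x - a) := by
  have two_mul_ne_zero : 2 * k ≠ 0 :=
    mul_ne_zero (Ring.two_ne_zero (by rwa [ZMod.ringChar_zmod_n])) hk
  obtain ⟨ε, hε, first⟩ : ∃ ε : ZMod p, (ε = 1 ∨ ε = -1) ∧ t (a + k) = t a + ε * k := by
    rcases h a with h | h
    · exact ⟨1, .inl rfl, by rw [h, one_mul]⟩
    · exact ⟨-1, .inr rfl, by rw [h, neg_one_mul, sub_eq_add_neg]⟩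
  -- The sign cannot change from one step to the next, as `t` would take a value twice.
  have step (x : ZMod p) (hx : t (x + k) = t x + ε * k) :
      t (x + k + k) = t (x + k) + ε * k := by
    have ne : t (x + k + k) ≠ t x := fun h ↦ two_mul_ne_zero (by linear_combination ht h)
    rcases h (x + k) with h | h <;> rcases hε with rfl | rfl <;>
      first
      | linear_combination h
      | exact absurd (by linear_combination h + hx) ne
  have multiples (n : ℕ) : t (a + n * k + k) = t (a + n * k) + ε * k ∧
      t (a + n * k) = t a + ε * (n * k) := by
    induction n with
    | zero => simpa using first
    | succ n ih =>
      have e : a + ((n + 1 : ℕ) : ZMod p) * k = a + n * k + k := by push_cast; ring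
      rw [e]
      refine ⟨step _ ih.1, ?_⟩
      rw [ih.1, ih.2]
      push_cast
      ring
  refine ⟨ε, hε, fun x ↦ ?_⟩
  have e : (((x - a) / k).val : ZMod p) * k = x - a := by
    rw [ZMod.natCast_zmod_val, div_mul_cancel₀ _ hk]
  simpa only [e, add_sub_cancel] using (multiples ((x - a) / k).val).2

theorem eq_self_of_forall_eq_add_or_sub {p : ℕ} [Fact p.Prime] (hp : p ≠ 2)
    {t : ZMod p → ZMod p} (ht : Function.Injective t) {k : ZMod p} (hk : k ≠ 0)
    (h : ∀ x, t (x + k) = t x + k ∨ t (x + k) = t x - k) {a b : ZMod p} (hab : a ≠ b)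
    (ha : t a = a) (hb : t b = b) (x : ZMod p) : t x = x := by
  obtain ⟨ε, rfl | rfl, ht⟩ := eq_add_mul_of_forall_eq_add_or_sub hp ht hk h a
  · rw [ht, ha]; ring
  · have : 2 * (b - a) = 0 := by linear_combination ht b - hb + ha
    exact absurd this (mul_ne_zero (Ring.two_ne_zero (by rwa [ZMod.ringChar_zmod_n]))
      (sub_ne_zero.2 hab.symm))

theorem PermutesTranslates.conj_affine {E : Finset (ZMod 7)} {t : ZMod 7 → ZMod 7}
    (ht : PermutesTranslates D t) (A : Equiv.Perm (ZMod 7)) {k c : ZMod 7}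
    (hA : ∀ x, A x = k * x + c) (hk : k ≠ 0) (hDE : ∀ x, x ∈ D ↔ A x ∈ E) :
    PermutesTranslates E (A ∘ t ∘ A.symm) := by
  have sub (x i : ZMod 7) : A x - k * i = A (x - i) := by rw [hA, hA]; ring
  intro i
  obtain ⟨j, hj⟩ := ht (k⁻¹ * i)
  refine ⟨k * j, fun x ↦ ?_⟩
  rw [Function.comp_apply, Function.comp_apply, sub, ← hDE, ← hj, hDE, ← sub,
    A.apply_symm_apply, mul_inv_cancel_left₀ hk]

theorem nonempty_mulEquiv_of_permutesTranslates {H : Type*} [Group H]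
    {ρ : H →* Equiv.Perm (ZMod 7)} (hinj : Function.Injective ρ) (hD : #D = 3)
    (hρ : ∀ h, PermutesTranslates D (ρ h)) {s τ : H} (hs : ∀ x, ρ s x = x + 1)
    (hτ : τ * τ = 1) (hτ1 : τ ≠ 1) {a b : ZMod 7} (hab : a ≠ b) (ha : ρ τ a = a)
    (hb : ρ τ b = b) : Nonempty (H ≃* SL(3, ZMod 2)) := by
  obtain ⟨k, hk, c, hDk⟩ | ⟨k, hk, hDk⟩ := affine_equiv_diffSet_or_exists_distCount_eq_two hD
  · let A : Equiv.Perm (ZMod 7) := (Equiv.mulLeft₀ k hk).trans (Equiv.addRight c)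
    have hA (x : ZMod 7) : A x = k * x + c := rfl
    have hpow (n : ℕ) (x : ZMod 7) : ρ (s ^ n) x = x + n := by
      induction n with
      | zero => simp
      | succ n ih => rw [pow_succ', map_mul, Equiv.Perm.mul_apply, ih, hs]; push_cast; ring
    refine nonempty_mulEquiv_of_permutesTranslates_diffSet (s := s ^ k⁻¹.val)
      (ρ := (MulAut.conj A).toMonoidHom.comp ρ) (fun h ↦ (hρ h).conj_affine A hA hk hDk)
      ((MulAut.conj A).injective.comp hinj) (fun x ↦ ?_) hτ hτ1
    change A (ρ _ (A.symm x)) = x + 1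
    rw [hpow, ZMod.natCast_zmod_val, hA, mul_add, mul_inv_cancel₀ hk, add_right_comm, ← hA,
      A.apply_symm_apply]
  · refine absurd (hinj (Equiv.ext fun x ↦ ?_)) hτ1
    have hcount (x y : ZMod 7) : distCount D (ρ τ y - ρ τ x) = distCount D (y - x) := by
      refine le_antisymm ?_ ((hρ τ).distCount_le hD x y)
      simpa using (hρ τ⁻¹).distCount_le hD (ρ τ x) (ρ τ y)
    rw [map_one, Equiv.Perm.one_apply]
    refine eq_self_of_forall_eq_add_or_sub (by norm_num) (ρ τ).injective hk (fun y ↦ ?_) hab ha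
      hb x
    have := (hDk (ρ τ (y + k) - ρ τ y)).1 (by rw [hcount, hDk, add_sub_cancel_left]; exact .inl rfl)
    rwa [sub_eq_iff_eq_add', sub_eq_iff_eq_add', ← sub_eq_add_neg] at this

theorem exists_equiv_zmod_smul_eq_add_one {p : ℕ} [Fact p.Prime] {G Ω : Type*} [Group G]
    [MulAction G Ω] [FaithfulSMul G Ω] [MulAction.IsPretransitive G Ω] (hΩ : Nat.card Ω = p) :
    ∃ (s : G) (e : ZMod p ≃ Ω), ∀ i, s • e i = e (i + 1) := by
  have : Finite Ω := Nat.finite_of_card_ne_zero (hΩ ▸ (Fact.out : p.Prime).ne_zero)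
  have : Finite G := Finite.of_injective _ (MulAction.toPerm_injective (α := G) (β := Ω))
  have : Nonempty Ω := (Nat.card_pos_iff.1 (hΩ ▸ (Fact.out : p.Prime).pos)).1
  have dvd_card : p ∣ Nat.card G := by
    rw [← hΩ, ← MulAction.index_stabilizer_of_transitive G (Classical.arbitrary Ω)]
    exact Subgroup.index_dvd_card _
  obtain ⟨s, hs⟩ := exists_prime_orderOf_dvd_card' p dvd_card
  have hsp : s ^ p = 1 := hs ▸ pow_orderOf_eq_one s
  obtain ⟨x, hx⟩ : ∃ x : Ω, s • x ≠ x := by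
    by_contra! h
    have : s = 1 := FaithfulSMul.eq_of_smul_eq_smul fun x : Ω ↦ by rw [h x, one_smul]
    exact (Fact.out : p.Prime).one_lt.ne (by rw [← hs, this, orderOf_one])
  have hper : Function.minimalPeriod (s • · : Ω → Ω) x = p :=
    Function.minimalPeriod_eq_prime (by simp only [Function.IsPeriodicPt, Function.IsFixedPt,
      smul_iterate, hsp, one_smul]) hx
  have hinj : Function.Injective fun i : ZMod p ↦ s ^ i.val • x := by
    intro i j hij
    refine ZMod.val_injective p <| Function.iterate_injOn_Iio_minimalPeriod (f := (s • ·)) (x := x)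
      (hper ▸ ZMod.val_lt i) (hper ▸ ZMod.val_lt j) ?_
    simpa only [smul_iterate] using hij
  refine ⟨s, .ofBijective _ ((Nat.bijective_iff_injective_and_card _).2
    ⟨hinj, by rw [hΩ, Nat.card_zmod]⟩), fun i ↦ ?_⟩
  rw [Equiv.ofBijective_apply, Equiv.ofBijective_apply, ← mul_smul, ← pow_succ', ZMod.val_add,
    ZMod.val_one'' (Fact.out : p.Prime).ne_one, ← pow_mod_orderOf, hs]

section Labelled

variable {G Ω : Type*} [Group G] [MulAction G Ω] {L : Set Ω} {s : G} {e : ZMod 7 ≃ Ω}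

theorem pow_smul_eq_add (he : ∀ i, s • e i = e (i + 1)) (n : ℕ) (i : ZMod 7) :
    s ^ n • e i = e (i + n) := by
  induction n with
  | zero => simp
  | succ n ih => rw [pow_succ', mul_smul, ih, he]; push_cast; rw [add_assoc]

theorem mem_pow_val_smul_iff {D : Finset (ZMod 7)} (hD : ∀ i, i ∈ D ↔ e i ∈ L)
    (he : ∀ i, s • e i = e (i + 1)) (j i : ZMod 7) : e i ∈ s ^ j.val • L ↔ i - j ∈ D := by
  rw [Set.mem_smul_set_iff_inv_smul_mem, hD]
  have : (s ^ j.val)⁻¹ • e i = e (i - j) := by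
    rw [inv_smul_eq_iff, pow_smul_eq_add he, ZMod.natCast_zmod_val, sub_add_cancel]
  rw [this]

theorem exists_pow_val_smul_eq_of_ncard_orbit_le {D : Finset (ZMod 7)}
    (hD : ∀ i, i ∈ D ↔ e i ∈ L) (hDcard : #D = 3) (he : ∀ i, s • e i = e (i + 1))
    (horb : (MulAction.orbit G L).ncard ≤ 7) (g : G) : ∃ j : ZMod 7, s ^ j.val • L = g • L := by
  have : Finite Ω := .of_equiv _ e
  let T (j : ZMod 7) : Set Ω := s ^ j.val • L
  have hT : Function.Injective T := fun i j hij ↦ eq_of_translate_eq hDcard fun x ↦ by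
    rw [← mem_pow_val_smul_iff hD he, ← mem_pow_val_smul_iff hD he]
    exact Set.ext_iff.1 hij (e x)
  have range_eq : Set.range T = MulAction.orbit G L := by
    refine Set.eq_of_subset_of_ncard_le ?_ (horb.trans_eq ?_)
    · rintro _ ⟨j, rfl⟩
      exact MulAction.mem_orbit L _
    · rw [Set.ncard_range_of_injective hT, Nat.card_zmod]
  exact range_eq.ge (MulAction.mem_orbit L g)

end Labelled

theorem nonempty_mulEquiv_of_ncard_orbit_le {H Ω : Type*} [Group H] [MulAction H Ω]
    [FaithfulSMul H Ω] [MulAction.IsPretransitive H Ω] (hΩ : Nat.card Ω = 7) {L : Set Ω}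
    (hL : L.ncard = 3) (horb : (MulAction.orbit H L).ncard ≤ 7) {τ : H} (hτ : τ * τ = 1)
    (hτ1 : τ ≠ 1) {a b : Ω} (hab : a ≠ b) (ha : τ • a = a) (hb : τ • b = b) :
    Nonempty (H ≃* SL(3, ZMod 2)) := by
  classical
  obtain ⟨s, e, he⟩ := exists_equiv_zmod_smul_eq_add_one (G := H) hΩ
  let ρ : H →* Equiv.Perm (ZMod 7) :=
    (Equiv.permCongrHom e.symm).toMonoidHom.comp (MulAction.toPermHom H Ω)
  have e_rho (h : H) (i : ZMod 7) : e (ρ h i) = h • e i := e.apply_symm_apply _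
  let D : Finset (ZMod 7) := {i | e i ∈ L}
  have hD (i : ZMod 7) : i ∈ D ↔ e i ∈ L := Finset.mem_filter_univ i
  have hDcard : #D = 3 := by
    rw [← Set.ncard_coe_finset, ← hL, ← Set.ncard_image_of_injective _ e.injective]
    congr 1
    ext x
    obtain ⟨i, rfl⟩ := e.surjective x
    simp [hD]
  refine nonempty_mulEquiv_of_permutesTranslates (ρ := ρ) (s := s) (D := D) (a := e.symm a)
    (b := e.symm b) ?_ hDcard (fun h i ↦ ?_) (fun x ↦ ?_) hτ hτ1 (e.symm.injective.ne hab) ?_ ?_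
  · exact (Equiv.permCongrHom e.symm).injective.comp MulAction.toPerm_injective
  · obtain ⟨j, hj⟩ := exists_pow_val_smul_eq_of_ncard_orbit_le hD hDcard he horb (h * s ^ i.val)
    refine ⟨j, fun x ↦ ?_⟩
    rw [← mem_pow_val_smul_iff hD he, ← mem_pow_val_smul_iff hD he, hj, e_rho, mul_smul,
      Set.smul_mem_smul_set_iff]
  all_goals apply e.injective; simp only [e_rho, he, e.apply_symm_apply, ha, hb]

theorem nonempty_mulEquiv_projectiveSpecialLinearGroup_three_two :
    Nonempty (SL(3, ZMod 2) ≃* ProjectiveSpecialLinearGroup (Fin 3) (ZMod 2)) := by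
  have center_eq_bot : Subgroup.center SL(3, ZMod 2) = ⊥ := by
    refine (Subgroup.eq_bot_iff_forall _).2 fun A hA ↦ Subtype.ext ?_
    obtain ⟨r, hr, hrA⟩ := Matrix.SpecialLinearGroup.mem_center_iff.1 hA
    obtain rfl | rfl := eq_zero_or_eq_one r
    · simp at hr
    · rw [← hrA, map_one]
      rfl
  exact ⟨QuotientGroup.quotientBot.symm.trans
    (QuotientGroup.quotientMulEquivOfEq center_eq_bot.symm)⟩

end Fano

end Fano

section Trinks

open Polynomial
open scoped MatrixGroups Pointwise

section RootSet

variable {F E : Type*} [Field F] [Field E] [Algebra F E]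

theorem faithfulSMul_rootSet (p : F[X]) [IsSplittingField F E p] :
    FaithfulSMul Gal(E/F) (p.rootSet E) where
  eq_of_smul_eq_smul {_ _} hgh := AlgEquiv.coe_toAlgHom_injective <|
    AlgHom.ext_of_adjoin_eq_top (IsSplittingField.adjoin_rootSet E p) fun x hx ↦
      congrArg Subtype.val (hgh ⟨x, hx⟩)

theorem isPretransitive_rootSet [Normal F E] {p : F[X]} (hp : Irreducible p) :
    MulAction.IsPretransitive Gal(E/F) (p.rootSet E) where
  exists_smul_eq x y := by
    have minpoly_eq : minpoly F (y : E) = minpoly F (x : E) :=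
      (minpoly.eq_of_irreducible hp (mem_rootSet.1 y.2).2).symm.trans
        (minpoly.eq_of_irreducible hp (mem_rootSet.1 x.2).2)
    obtain ⟨g, hg⟩ := (Normal.minpoly_eq_iff_mem_orbit E).1 minpoly_eq
    exact ⟨g, Subtype.ext hg⟩

end RootSet

section ComplexConj

variable (E : Type*) [Field E] [Algebra ℚ E] [Algebra E ℂ] [IsScalarTower ℚ E ℂ] [Normal ℚ E]

/-- The automorphism that complex conjugation induces on a normal extension of `ℚ` inside `ℂ`. -/
noncomputable def complexConj : Gal(E/ℚ) :=
  (Complex.conjAe.restrictScalars ℚ).restrictNormal E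

variable {E}

theorem algebraMap_complexConj (x : E) :
    algebraMap E ℂ (complexConj E x) = (starRingEnd ℂ) (algebraMap E ℂ x) :=
  AlgEquiv.restrictNormal_commutes (Complex.conjAe.restrictScalars ℚ) E x

theorem complexConj_mul_self : complexConj E * complexConj E = 1 := by
  ext x
  apply (algebraMap E ℂ).injective
  rw [AlgEquiv.mul_apply, algebraMap_complexConj, algebraMap_complexConj, Complex.conj_conj,
    AlgEquiv.one_apply]

theorem exists_complexConj_smul_eq_self {p : ℚ[X]} (hp : (p.map (algebraMap ℚ E)).Splits)
    {r : ℝ} (hr : r ∈ p.rootSet ℝ) :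
    ∃ x : p.rootSet E, algebraMap E ℂ x = r ∧ complexConj E • x = x := by
  obtain ⟨hp0, hr⟩ := mem_rootSet.1 hr
  have aeval_ofReal : aeval (r : ℂ) p = 0 := by
    rw [← Complex.coe_algebraMap, aeval_algebraMap_apply, hr, map_zero]
  have isRoot : IsRoot ((p.map (algebraMap ℚ E)).map (algebraMap E ℂ)) (r : ℂ) := by
    rwa [map_map, ← IsScalarTower.algebraMap_eq, IsRoot, eval_map_algebraMap]
  obtain ⟨x, hx⟩ := hp.mem_range_of_isRoot (Polynomial.map_ne_zero hp0) isRoot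
  have aeval_x : aeval x p = 0 := (algebraMap E ℂ).injective <| by
    rw [← aeval_algebraMap_apply, hx, aeval_ofReal, map_zero]
  refine ⟨⟨x, mem_rootSet.2 ⟨hp0, aeval_x⟩⟩, hx, Subtype.ext ?_⟩
  apply (algebraMap E ℂ).injective
  rw [rootSet.coe_smul, AlgEquiv.smul_def, algebraMap_complexConj, hx, Complex.conj_ofReal]

theorem complexConj_ne_one {p : ℚ[X]} (hp : (p.rootSet ℝ).ncard < (p.rootSet E).ncard) :
    complexConj E ≠ 1 := by
  intro h
  have ofReal_re (x : E) : ((algebraMap E ℂ x).re : ℂ) = algebraMap E ℂ x := by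
    rw [← Complex.conj_eq_iff_re, ← algebraMap_complexConj, h, AlgEquiv.one_apply]
  refine hp.not_ge <| Set.ncard_le_ncard_of_injOn (fun x ↦ (algebraMap E ℂ x).re)
    (fun x hx ↦ ?_) (fun x _ y _ hxy ↦ ?_)
  · obtain ⟨hp0, hx⟩ := mem_rootSet.1 hx
    refine mem_rootSet.2 ⟨hp0, (algebraMap ℝ ℂ).injective ?_⟩
    rw [← aeval_algebraMap_apply, Complex.coe_algebraMap, ofReal_re, aeval_algebraMap_apply, hx,
      map_zero, Complex.ofReal_zero]
  · apply (algebraMap E ℂ).injective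
    rw [← ofReal_re x, ← ofReal_re y]
    exact congrArg _ hxy

end ComplexConj

namespace Trinks

/-- Trinks' polynomial `X ^ 7 - 7 X + 3`, whose Galois group over `ℚ` is simple of order 168. -/
noncomputable def poly (R : Type*) [CommRing R] : R[X] := X ^ 7 - C 7 * X + C 3

theorem map_poly {R S : Type*} [CommRing R] [CommRing S] (φ : R →+* S) :
    (poly R).map φ = poly S := by
  simp [poly, map_ofNat]

theorem natDegree_poly (R : Type*) [CommRing R] [Nontrivial R] : (poly R).natDegree = 7 := by
  rw [poly]; compute_degree!

theorem monic_poly (R : Type*) [CommRing R] [Nontrivial R] : (poly R).Monic := by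
  rw [poly]; monicity!

theorem eval_poly {R : Type*} [CommRing R] (x : R) : (poly R).eval x = x ^ 7 - 7 * x + 3 := by
  simp [poly]

theorem mem_rootSet_poly {K E : Type*} [Field K] [Field E] [Algebra K E] (x : E) :
    x ∈ (poly K).rootSet E ↔ (poly E).eval x = 0 := by
  rw [mem_rootSet_of_ne (monic_poly K).ne_zero, ← eval_map_algebraMap, map_poly]

theorem irreducible_poly_int : Irreducible (poly ℤ) := by
  rw [← MulEquiv.irreducible_iff (algEquivAevalXAddC (-3 : ℤ))]
  set g : ℤ[X] := algEquivAevalXAddC (-3 : ℤ) (poly ℤ)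
  have hg : g = X ^ 7 + C (-21) * X ^ 6 + C 189 * X ^ 5 + C (-945) * X ^ 4 + C 2835 * X ^ 3 +
      C (-5103) * X ^ 2 + C 5096 * X + C (-2163) := by
    simp only [g, poly, algEquivAevalXAddC_apply, map_add, map_sub, map_mul, map_pow, aeval_X,
      map_neg, map_ofNat]
    ring
  have natDegree_eq : g.natDegree = 7 := by rw [hg]; compute_degree!
  have monic : g.Monic := by rw [hg]; monicity!
  have eisenstein : g.IsEisensteinAt (Ideal.span {7}) := by
    refine ⟨?_, ?_, ?_⟩
    · rw [monic.leadingCoeff, Ideal.mem_span_singleton]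
      norm_num
    · intro n hn
      rw [natDegree_eq] at hn
      rw [Ideal.mem_span_singleton]
      interval_cases n <;> simp [hg, coeff_X]
    · rw [Ideal.span_singleton_pow, Ideal.mem_span_singleton]
      simp [hg]
  refine eisenstein.irreducible ?_ monic.isPrimitive (by rw [natDegree_eq]; norm_num)
  rw [Ideal.span_singleton_prime (by norm_num)]
  exact Int.prime_iff_natAbs_prime.2 (by norm_num)

theorem irreducible_poly : Irreducible (poly ℚ) := by
  rw [← map_poly (Int.castRingHom ℚ)]
  exact (monic_poly ℤ).irreducible_iff_irreducible_map_fraction_map.1 irreducible_poly_int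

theorem exists_ne_mem_rootSet_real :
    ∃ x ∈ (poly ℚ).rootSet ℝ, ∃ y ∈ (poly ℚ).rootSet ℝ, x ≠ y := by
  have hcont : Continuous fun x : ℝ ↦ (poly ℝ).eval x := (poly ℝ).continuous
  obtain ⟨x, hx, hx0⟩ := intermediate_value_Icc (by norm_num : (-2 : ℝ) ≤ 0) hcont.continuousOn
    (show (0 : ℝ) ∈ Set.Icc _ _ by simp only [eval_poly]; norm_num)
  obtain ⟨y, hy, hy0⟩ := intermediate_value_Icc' (by norm_num : (0 : ℝ) ≤ 1) hcont.continuousOn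
    (show (0 : ℝ) ∈ Set.Icc _ _ by simp only [eval_poly]; norm_num)
  refine ⟨x, (mem_rootSet_poly x).2 hx0, y, (mem_rootSet_poly y).2 hy0, ?_⟩
  rintro rfl
  obtain rfl : x = 0 := le_antisymm hx.2 hy.1
  simp [eval_poly] at hx0

theorem ncard_rootSet_real_lt : ((poly ℚ).rootSet ℝ).ncard < 7 := by
  have rootSet_derivative : (derivative (poly ℚ)).rootSet ℝ ⊆ {1, -1} := by
    intro x hx
    have hx6 : x ^ 6 = 1 := by
      have := (mem_rootSet.1 hx).2
      simp only [poly, derivative_sub, derivative_X_pow_succ, Nat.cast_ofNat,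
        map_add, map_one, derivative_mul, derivative_C, zero_mul, derivative_X, mul_one, zero_add,
        add_zero, aeval_sub, map_mul, aeval_C, eq_ratCast, Rat.cast_ofNat, map_pow,
        aeval_X] at this
      linarith
    have : (x ^ 2 - 1) * (x ^ 4 + x ^ 2 + 1) = 0 := by linear_combination hx6
    exact sq_eq_one_iff.1 <|
      sub_eq_zero.1 <| (mul_eq_zero.1 this).resolve_right (by positivity)
  have rolle := card_rootSet_le_derivative (poly ℚ)
  rw [← Nat.card_eq_fintype_card, ← Nat.card_eq_fintype_card, Nat.card_coe_set_eq,
    Nat.card_coe_set_eq] at rolle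
  calc _ ≤ ((derivative (poly ℚ)).rootSet ℝ).ncard + 1 := rolle
    _ ≤ ({1, -1} : Set ℝ).ncard + 1 := by gcongr; exact Set.toFinite _
    _ = 3 := by rw [Set.ncard_pair (by norm_num)]
    _ < 7 := by norm_num

/-- The factor of degree 7 of the polynomial of degree 35 whose roots are the sums of three
distinct roots of `poly`; its roots are the sums over the lines of a Fano plane on the roots. -/
noncomputable def resolvent (R : Type*) [CommRing R] : R[X] :=
  X ^ 7 + C 14 * X ^ 4 - C 42 * X ^ 2 - C 21 * X + C 9

theorem natDegree_resolvent (R : Type*) [CommRing R] [Nontrivial R] :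
    (resolvent R).natDegree = 7 := by
  rw [resolvent]; compute_degree!

theorem map_resolvent {R S : Type*} [CommRing R] [CommRing S] (φ : R →+* S) :
    (resolvent R).map φ = resolvent S := by
  simp [resolvent, map_ofNat]

section Cubic

variable {E : Type*} [Field E]

/-- The second elementary symmetric function of the three roots on the line with sum `d`, as a
polynomial in `d`. -/
def esymmTwo (d : E) : E :=
  23 / 3 * d ^ 6 - 12 * d ^ 5 + 19 * d ^ 4 + 232 / 3 * d ^ 3 - 120 * d ^ 2 - 131 * d + 42

/-- The product of the three roots on the line with sum `d`, as a polynomial in `d`. -/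
def esymmThree (d : E) : E :=
  -(32 / 3) * d ^ 6 + 17 * d ^ 5 - 27 * d ^ 4 - 319 / 3 * d ^ 3 + 170 * d ^ 2 + 178 * d - 61

/-- The cubic polynomial whose roots form the line with sum `d`. -/
noncomputable def cubic (d : E) : E[X] :=
  X ^ 3 - C d * X ^ 2 + C (esymmTwo d) * X - C (esymmThree d)

theorem eval_cubic (d x : E) :
    (cubic d).eval x = x ^ 3 - d * x ^ 2 + esymmTwo d * x - esymmThree d := by
  simp [cubic]

theorem natDegree_cubic (d : E) : (cubic d).natDegree = 3 := by
  rw [cubic]; compute_degree!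

theorem monic_cubic (d : E) : (cubic d).Monic := by
  rw [cubic]; monicity!

theorem map_cubic {E' : Type*} [Field E'] (φ : E →+* E') (d : E) :
    (cubic d).map φ = cubic (φ d) := by
  simp [cubic, esymmTwo, esymmThree, map_ofNat]

theorem sum_roots_cubic {d : E} (h : (cubic d).Splits) : (cubic d).roots.sum = d := by
  have := h.nextCoeff_eq_neg_sum_roots_of_monic (monic_cubic d)
  rw [nextCoeff_of_natDegree_pos (by rw [natDegree_cubic]; norm_num), natDegree_cubic] at this
  simpa [cubic, eq_comm] using this

theorem cubic_dvd_poly [CharZero E] {d : E} (hd : (resolvent E).IsRoot d) :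
    cubic d ∣ poly E := by
  have hd' : d ^ 7 + 14 * d ^ 4 - 42 * d ^ 2 - 21 * d + 9 = 0 := by
    simpa [resolvent] using hd.eq_zero
  refine ⟨X ^ 4 + C d * X ^ 3 + C (-(23 / 3) * d ^ 6 + 12 * d ^ 5 - 19 * d ^ 4 - 232 / 3 * d ^ 3
    + 121 * d ^ 2 + 131 * d - 42) * X ^ 2 + C (40 / 3 * d ^ 6 - 21 * d ^ 5 + 33 * d ^ 4
    + 404 / 3 * d ^ 3 - 212 * d ^ 2 - 228 * d + 77) * X + C (-(14 / 3) * d ^ 6 + 7 * d ^ 5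
    - 11 * d ^ 4 - 145 / 3 * d ^ 3 + 71 * d ^ 2 + 84 * d - 24), ?_⟩
  refine Polynomial.funext fun x ↦ ?_
  simp only [eval_mul, eval_cubic, eval_poly, eval_add, eval_pow, eval_X, eval_C, esymmTwo,
    esymmThree]
  linear_combination (-(46 / 3 * x ^ 4 + (-(529 / 9) * d ^ 5 + 184 * d ^ 4 - 1306 / 3 * d ^ 3
    + 838 / 9 * d ^ 2 + 2300 / 3 * d - 596 / 3) * x ^ 3 + (184 / 9 * d ^ 5 - 188 / 3 * d ^ 4
    + 434 / 3 * d ^ 3 - 97 / 9 * d ^ 2 - 868 / 3 * d + 224 / 3) * x ^ 2 + (958 / 9 * d ^ 5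
    - 341 * d ^ 4 + 812 * d ^ 3 - 2074 / 9 * d ^ 2 - 4106 / 3 * d + 1232 / 3) * x
    + (-(448 / 9) * d ^ 5 + 154 * d ^ 4 - 1087 / 3 * d ^ 3 + 550 / 9 * d ^ 2 + 1991 / 3 * d
    - 163))) * hd'

theorem exists_isRoot_resolvent [CharZero E] (h : (poly E).Splits) :
    ∃ d : E, (resolvent E).IsRoot d := by
  let A := AlgebraicClosure E
  obtain ⟨δ, hδ⟩ : ∃ δ : A, (resolvent A).IsRoot δ := by
    refine IsAlgClosed.exists_root _ (ne_of_gt ?_)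
    rw [← natDegree_pos_iff_degree_pos, natDegree_resolvent]
    norm_num
  have : CharZero A := charZero_of_injective_algebraMap (algebraMap E A).injective
  have root_mem_range (x : A) (hx : x ∈ (cubic δ).roots) : x ∈ (algebraMap E A).range := by
    refine h.mem_range_of_isRoot (monic_poly E).ne_zero ?_
    rw [map_poly]
    exact (isRoot_of_mem_roots hx).dvd (cubic_dvd_poly hδ)
  obtain ⟨d, rfl⟩ : δ ∈ (algebraMap E A).range :=
    sum_roots_cubic (IsAlgClosed.splits (cubic δ)) ▸ multiset_sum_mem _ root_mem_range
  exact ⟨d, (isRoot_map_iff (algebraMap E A).injective).1 (by rwa [map_resolvent])⟩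

end Cubic

section Line

variable {E : Type*} [Field E] [Algebra ℚ E]

/-- The roots of `cubic d`, as a set of roots of `poly`. -/
def line (d : E) : Set ((poly ℚ).rootSet E) := {x | (cubic d).IsRoot (x : E)}

theorem smul_line (g : Gal(E/ℚ)) (d : E) : g • line d = line (g d) := by
  ext x
  obtain ⟨y, rfl⟩ := MulAction.surjective g x
  rw [Set.smul_mem_smul_set_iff]
  change _ ↔ (cubic ((g : E →+* E) d)).IsRoot ((g : E →+* E) y)
  rw [← map_cubic, isRoot_map_iff (RingHom.injective _)]
  rfl

theorem ncard_line (h : (poly E).Splits) {d : E} (hd : (resolvent E).IsRoot d) :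
    (line d).ncard = 3 := by
  have : CharZero E := algebraRat.charZero E
  have hdvd := cubic_dvd_poly hd
  have separable : (poly E).Separable :=
    map_poly (algebraMap ℚ E) ▸ irreducible_poly.separable.map
  have coe_image_line : (↑) '' line d = (cubic d).rootSet E := by
    ext x
    rw [mem_rootSet_of_ne (monic_cubic d).ne_zero, coe_aeval_eq_eval]
    refine ⟨?_, fun hx ↦ ⟨⟨x, (mem_rootSet_poly x).2 (IsRoot.dvd hx hdvd)⟩, hx, rfl⟩⟩
    rintro ⟨y, hy, rfl⟩
    exact hy
  rw [← Set.ncard_image_of_injective _ Subtype.val_injective, coe_image_line,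
    ← Nat.card_coe_set_eq, Nat.card_eq_fintype_card,
    card_rootSet_eq_natDegree (separable.of_dvd hdvd), natDegree_cubic]
  rw [Algebra.algebraMap_self, map_id]
  exact h.of_dvd (monic_poly E).ne_zero hdvd

theorem ncard_orbit_line_le {d : E} (hd : (resolvent E).IsRoot d) :
    (MulAction.orbit Gal(E/ℚ) (line d)).ncard ≤ 7 := by
  classical
  have resolvent_ne_zero : resolvent E ≠ 0 := ne_zero_of_natDegree_gt
    (n := 0) (by rw [natDegree_resolvent]; norm_num)
  have orbit_subset : MulAction.orbit Gal(E/ℚ) (line d) ⊆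
      line '' ((resolvent E).roots.toFinset : Set E) := by
    rintro _ ⟨g, rfl⟩
    refine ⟨g d, ?_, (smul_line g d).symm⟩
    rw [Finset.mem_coe, Multiset.mem_toFinset, mem_roots resolvent_ne_zero]
    have := hd.map (f := (g : E →+* E))
    rwa [map_resolvent] at this
  calc _ ≤ (line '' ((resolvent E).roots.toFinset : Set E)).ncard :=
        Set.ncard_le_ncard orbit_subset (Set.toFinite _)
    _ ≤ (resolvent E).roots.toFinset.card :=
        (Set.ncard_image_le (Set.toFinite _)).trans_eq (Set.ncard_coe_finset _)
    _ ≤ (resolvent E).natDegree := (Multiset.toFinset_card_le _).trans (card_roots' _)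
    _ = 7 := natDegree_resolvent E

end Line

theorem nonempty_gal_mulEquiv (E : Type*) [Field E] [Algebra ℚ E] [Algebra E ℂ]
    [IsScalarTower ℚ E ℂ] [IsSplittingField ℚ E (poly ℚ)] :
    Nonempty (Gal(E/ℚ) ≃* SL(3, ZMod 2)) := by
  have splits := IsSplittingField.splits E (poly ℚ)
  have splits' : (poly E).Splits := map_poly (algebraMap ℚ E) ▸ splits
  have : CharZero E := algebraRat.charZero E
  have : Normal ℚ E := .of_isSplittingField (poly ℚ)
  have := faithfulSMul_rootSet (E := E) (poly ℚ)
  have := isPretransitive_rootSet (E := E) irreducible_poly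
  have card_roots : Nat.card ((poly ℚ).rootSet E) = 7 := by
    rw [Nat.card_eq_fintype_card, card_rootSet_eq_natDegree irreducible_poly.separable splits,
      natDegree_poly]
  obtain ⟨d, hd⟩ := exists_isRoot_resolvent splits'
  obtain ⟨x, hx, y, hy, hxy⟩ := exists_ne_mem_rootSet_real
  obtain ⟨a, a_eq, ha⟩ := exists_complexConj_smul_eq_self splits hx
  obtain ⟨b, b_eq, hb⟩ := exists_complexConj_smul_eq_self splits hy
  have hab : a ≠ b := by
    rintro rfl
    exact hxy (Complex.ofReal_injective (a_eq.symm.trans b_eq))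
  exact Fano.nonempty_mulEquiv_of_ncard_orbit_le card_roots (ncard_line splits' hd)
    (ncard_orbit_line_le hd) complexConj_mul_self
    (complexConj_ne_one (ncard_rootSet_real_lt.trans_eq card_roots.symm)) hab ha hb

end Trinks

theorem exists_isGalois_rat_projectiveSpecialLinearGroup_three_two :
    ∃ (M : Type) (_ : Field M) (_ : NumberField M), IsGalois ℚ M ∧
      Nonempty (Gal(M/ℚ) ≃* Matrix.ProjectiveSpecialLinearGroup (Fin 3) (ZMod 2)) := by
  let M := IntermediateField.adjoin ℚ ((Trinks.poly ℚ).rootSet ℂ)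
  have : IsSplittingField ℚ M (Trinks.poly ℚ) :=
    IntermediateField.adjoin_rootSet_isSplittingField (IsAlgClosed.splits _)
  have : FiniteDimensional ℚ M := IsSplittingField.finiteDimensional M (Trinks.poly ℚ)
  obtain ⟨e⟩ := Trinks.nonempty_gal_mulEquiv M
  obtain ⟨f⟩ := Fano.nonempty_mulEquiv_projectiveSpecialLinearGroup_three_two
  exact ⟨M, inferInstance, ⟨⟩, .of_separable_splitting_field Trinks.irreducible_poly.separable,
    ⟨e.trans f⟩⟩

end Trinks

section Stabilizers

open Matrix
open scoped Pointwise

variable {d : ℕ} {F : Type*} [Field F]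

theorem mem_slStabilizer_of_forall_mem {W : Submodule F (Fin d → F)}
    {A : SpecialLinearGroup (Fin d) F} (h : ∀ x ∈ W, A.1 *ᵥ x ∈ W) : A ∈ slStabilizer W := by
  refine Submodule.eq_of_le_of_finrank_eq ?_ (LinearEquiv.finrank_map_eq _ W)
  rintro _ ⟨x, hx, rfl⟩
  exact h x hx

theorem mem_slStabilizer_iff {W : Submodule F (Fin d → F)} {A : SpecialLinearGroup (Fin d) F} :
    A ∈ slStabilizer W ↔ ∀ x ∈ W, A.1 *ᵥ x ∈ W :=
  ⟨fun h x hx ↦ h.le ⟨x, hx, rfl⟩, mem_slStabilizer_of_forall_mem⟩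

theorem center_le_slStabilizer (W : Submodule F (Fin d → F)) :
    Subgroup.center (SpecialLinearGroup (Fin d) F) ≤ slStabilizer W := by
  intro A hA
  obtain ⟨r, -, hr⟩ := Matrix.SpecialLinearGroup.mem_center_iff.1 hA
  refine mem_slStabilizer_iff.2 fun x hx ↦ ?_
  rw [← hr, scalar_apply, ← smul_one_eq_diagonal, smul_mulVec, one_mulVec]
  exact W.smul_mem r hx

theorem comap_pslStabilizer (W : Submodule F (Fin d → F)) :
    (pslStabilizer W).comap (QuotientGroup.mk' (Subgroup.center _)) = slStabilizer W :=
  Subgroup.comap_map_eq_self ((QuotientGroup.ker_mk' _).trans_le (center_le_slStabilizer W))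

theorem mk_mem_pslStabilizer {W : Submodule F (Fin d → F)} {A : SpecialLinearGroup (Fin d) F} :
    QuotientGroup.mk' (Subgroup.center _) A ∈ pslStabilizer W ↔ A ∈ slStabilizer W := by
  rw [← Subgroup.mem_comap, comap_pslStabilizer]

theorem map_conj_slStabilizer (W : Submodule F (Fin d → F)) (g : SpecialLinearGroup (Fin d) F) :
    (slStabilizer W).map (MulAut.conj g).toMonoidHom = slStabilizer (g • W) :=
  (MulAction.stabilizer_smul_eq_stabilizer_map_conj g W).symm

theorem map_conj_pslStabilizer (W : Submodule F (Fin d → F)) (g : SpecialLinearGroup (Fin d) F) :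
    (pslStabilizer W).map (MulAut.conj (QuotientGroup.mk' (Subgroup.center _) g)).toMonoidHom =
      pslStabilizer (g • W) := by
  rw [pslStabilizer, pslStabilizer, ← map_conj_slStabilizer, Subgroup.map_map, Subgroup.map_map]
  rfl

/-- The hyperplane of `F^d` orthogonal to `w` for the dot product, by which hyperplanes are
parametrized by nonzero vectors up to scalars (for `w = 0` it is the whole space). -/
def dotHyperplane (w : Fin d → F) : Submodule F (Fin d → F) :=
  LinearMap.ker (dotProductEquiv F (Fin d) w)

theorem mem_dotHyperplane {w x : Fin d → F} : x ∈ dotHyperplane w ↔ w ⬝ᵥ x = 0 :=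
  Iff.rfl

theorem finrank_dotHyperplane_add_one {w : Fin d → F} (hw : w ≠ 0) :
    Module.finrank F (dotHyperplane w) + 1 = d := by
  rw [dotHyperplane, Module.Dual.finrank_ker_add_one_of_ne_zero
    ((LinearEquiv.map_ne_zero_iff _).2 hw), Module.finrank_fin_fun]

theorem exists_eq_dotHyperplane {W : Submodule F (Fin d → F)} (hW : Module.finrank F W + 1 = d) :
    ∃ w : Fin d → F, w ≠ 0 ∧ W = dotHyperplane w := by
  have hlt : W < ⊤ := by
    rw [lt_top_iff_ne_top]
    rintro rfl
    rw [finrank_top, Module.finrank_fin_fun] at hW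
    lia
  obtain ⟨f, hf, hWf⟩ := W.exists_le_ker_of_lt_top hlt
  obtain ⟨w, rfl⟩ := (dotProductEquiv F (Fin d)).surjective f
  have hw : w ≠ 0 := (LinearEquiv.map_ne_zero_iff _).1 hf
  refine ⟨w, hw, Submodule.eq_of_le_of_finrank_eq hWf ?_⟩
  have := finrank_dotHyperplane_add_one hw
  change _ = Module.finrank F (dotHyperplane w)
  lia

theorem exists_eq_smul_of_dotHyperplane_le {v w : Fin d → F}
    (h : dotHyperplane v ≤ dotHyperplane w) : ∃ c : F, w = c • v := by
  obtain ⟨c, hc⟩ := (Submodule.mem_span_range_iff_exists_fun F).1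
    (mem_span_of_iInf_ker_le_ker (L := fun _ : Unit ↦ dotProductEquiv F (Fin d) v)
      ((iInf_const (ι := Unit)).trans_le h))
  refine ⟨c (), (dotProductEquiv F (Fin d)).injective ?_⟩
  rw [map_smul, ← hc, Fintype.sum_unique, PUnit.default_eq_unit]

theorem exists_eq_span_singleton_of_finrank_eq_one {W : Submodule F (Fin d → F)}
    (hW : Module.finrank F W = 1) : ∃ v : Fin d → F, v ≠ 0 ∧ W = Submodule.span F {v} := by
  obtain ⟨v, hv⟩ := Module.finrank_pos_iff_exists_ne_zero.1 (hW ▸ one_pos)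
  refine ⟨v, fun h ↦ hv (Subtype.ext h), (Submodule.eq_of_le_of_finrank_eq
    ((Submodule.span_singleton_le_iff_mem _ _).2 v.2) ?_).symm⟩
  rw [finrank_span_singleton fun h ↦ hv (Subtype.ext h), hW]

theorem mem_slStabilizer_span_singleton {v : Fin d → F} {A : SpecialLinearGroup (Fin d) F} :
    A ∈ slStabilizer (Submodule.span F {v}) ↔ ∃ c : F, A.1 *ᵥ v = c • v := by
  rw [mem_slStabilizer_iff]
  refine ⟨fun h ↦ (Submodule.mem_span_singleton.1
    (h v (Submodule.mem_span_singleton_self v))).imp fun _ ↦ Eq.symm, ?_⟩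
  rintro ⟨c, hc⟩ x hx
  obtain ⟨a, rfl⟩ := Submodule.mem_span_singleton.1 hx
  rw [mulVec_smul, hc]
  exact Submodule.smul_mem _ _ (Submodule.smul_mem _ _ (Submodule.mem_span_singleton_self v))

theorem mem_slStabilizer_dotHyperplane {w : Fin d → F} {A : SpecialLinearGroup (Fin d) F} :
    A ∈ slStabilizer (dotHyperplane w) ↔ ∃ c : F, A.1ᵀ *ᵥ w = c • w := by
  have dotProduct_transpose (x : Fin d → F) : (A.1ᵀ *ᵥ w) ⬝ᵥ x = w ⬝ᵥ (A.1 *ᵥ x) := by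
    rw [mulVec_transpose, dotProduct_mulVec]
  constructor
  · intro h
    refine exists_eq_smul_of_dotHyperplane_le fun x hx ↦ ?_
    rw [mem_dotHyperplane, dotProduct_transpose]
    exact mem_slStabilizer_iff.1 h x hx
  · rintro ⟨c, hc⟩
    refine mem_slStabilizer_iff.2 fun x hx ↦ ?_
    rw [mem_dotHyperplane, ← dotProduct_transpose, hc, smul_dotProduct, mem_dotHyperplane.1 hx,
      smul_zero]

end Stabilizers

section Duality

open Matrix
open scoped Pointwise

variable {d : ℕ} {F : Type*} [Field F]

theorem sl_transpose_mul (A B : SpecialLinearGroup (Fin d) F) :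
    (A * B).transpose = B.transpose * A.transpose :=
  Subtype.ext (transpose_mul A.1 B.1)

theorem sl_inv_transpose_inv_transpose (A : SpecialLinearGroup (Fin d) F) :
    A.transpose⁻¹.transpose⁻¹ = A := by
  refine inv_eq_of_mul_eq_one_right ?_
  calc A.transpose⁻¹.transpose * A
      = (A.transpose * A.transpose⁻¹).transpose := (sl_transpose_mul A.transpose _).symm
    _ = 1 := by rw [mul_inv_cancel]; exact Subtype.ext transpose_one

/-- The automorphism `A ↦ (Aᵀ)⁻¹` of `SL_d(F)`, which interchanges the stabilizers of lines and
of hyperplanes. -/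
def slInvTranspose (d : ℕ) (F : Type*) [Field F] : MulAut (SpecialLinearGroup (Fin d) F) where
  toFun A := A.transpose⁻¹
  invFun A := A.transpose⁻¹
  left_inv := sl_inv_transpose_inv_transpose
  right_inv := sl_inv_transpose_inv_transpose
  map_mul' A B := by rw [sl_transpose_mul, _root_.mul_inv_rev]

theorem slInvTranspose_mem_slStabilizer_dotHyperplane {w : Fin d → F}
    {A : SpecialLinearGroup (Fin d) F} :
    slInvTranspose d F A ∈ slStabilizer (dotHyperplane w) ↔
      A ∈ slStabilizer (Submodule.span F {w}) := by
  change A.transpose⁻¹ ∈ _ ↔ _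
  rw [inv_mem_iff, mem_slStabilizer_dotHyperplane, mem_slStabilizer_span_singleton,
    SpecialLinearGroup.coe_transpose, transpose_transpose]

/-- The automorphism of `PSL_d(F)` induced by `slInvTranspose`. -/
def pslInvTranspose (d : ℕ) (F : Type*) [Field F] :
    MulAut (ProjectiveSpecialLinearGroup (Fin d) F) :=
  QuotientGroup.congr _ _ (slInvTranspose d F)
    (Subgroup.characteristic_iff_map_eq.1 inferInstance (slInvTranspose d F))

theorem map_pslInvTranspose (w : Fin d → F) :
    (pslStabilizer (Submodule.span F {w})).map (pslInvTranspose d F).toMonoidHom =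
      pslStabilizer (dotHyperplane w) := by
  apply le_antisymm
  · rintro _ ⟨_, ⟨A, hA, rfl⟩, rfl⟩
    exact ⟨slInvTranspose d F A, slInvTranspose_mem_slStabilizer_dotHyperplane.2 hA, rfl⟩
  · rintro _ ⟨B, hB, rfl⟩
    obtain ⟨A, rfl⟩ := (slInvTranspose d F).surjective B
    exact ⟨_, ⟨A, slInvTranspose_mem_slStabilizer_dotHyperplane.1 hB, rfl⟩, rfl⟩

theorem exists_smul_span_singleton_eq {v w : Fin d → F} (hv : v ≠ 0) (hw : w ≠ 0) :
    ∃ g : SpecialLinearGroup (Fin d) F, g • Submodule.span F {v} = Submodule.span F {w} := by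
  obtain ⟨g, hg⟩ := MulAction.exists_smul_eq (SpecialLinearGroup (Fin d) F)
    (Projectivization.mk F v hv) (Projectivization.mk F w hw)
  rw [Projectivization.smul_mk, Projectivization.mk_eq_mk_iff] at hg
  obtain ⟨a, ha⟩ := hg
  refine ⟨g, ?_⟩
  rw [Submodule.smul_span, Set.smul_set_singleton, ← ha]
  exact Submodule.span_singleton_smul_eq a.isUnit w

theorem exists_mulAut_map_pslStabilizer_span_eq {v w : Fin d → F} (hv : v ≠ 0) (hw : w ≠ 0) :
    ∃ φ : MulAut (ProjectiveSpecialLinearGroup (Fin d) F),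
      (pslStabilizer (Submodule.span F {v})).map φ.toMonoidHom =
        pslStabilizer (dotHyperplane w) := by
  obtain ⟨g, hg⟩ := exists_smul_span_singleton_eq hv hw
  refine ⟨(MulAut.conj (QuotientGroup.mk' _ g)).trans (pslInvTranspose d F), ?_⟩
  rw [← map_pslInvTranspose w, ← hg, ← map_conj_pslStabilizer, Subgroup.map_map]
  rfl

end Duality

section Maximality

open Matrix

variable {d : ℕ} {F : Type*} [Field F]

theorem pslStabilizer_span_singleton_eq_stabilizer {v : Fin d → F} (hv : v ≠ 0) :
    pslStabilizer (Submodule.span F {v}) =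
      MulAction.stabilizer (ProjectiveSpecialLinearGroup (Fin d) F)
        (Projectivization.mk F v hv) := by
  ext x
  obtain ⟨A, rfl⟩ := QuotientGroup.mk'_surjective _ x
  rw [mk_mem_pslStabilizer, mem_slStabilizer_span_singleton, MulAction.mem_stabilizer_iff,
    QuotientGroup.mk'_apply, ProjectiveSpecialLinearGroup.smul_proj_mk, Projectivization.smul_mk,
    Projectivization.mk_eq_mk_iff']
  exact exists_congr fun c ↦ eq_comm

theorem isCoatom_pslStabilizer_span_singleton (hd : 2 ≤ d) {v : Fin d → F} (hv : v ≠ 0) :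
    IsCoatom (pslStabilizer (Submodule.span F {v})) := by
  have : Nontrivial (Fin d) := Fin.nontrivial_iff_two_le.2 hd
  have : Nontrivial (Projectivization F (Fin d → F)) := by
    obtain ⟨i, j, hij⟩ := exists_pair_ne (Fin d)
    refine ⟨.mk F (Pi.single i 1) (by simp), .mk F (Pi.single j 1) (by simp), fun h ↦ ?_⟩
    obtain ⟨a, ha⟩ := (Projectivization.mk_eq_mk_iff' ..).1 h
    simpa [hij] using congrFun ha i
  rw [pslStabilizer_span_singleton_eq_stabilizer hv,
    MulAction.isCoatom_stabilizer_iff_preprimitive]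
  infer_instance

theorem isCoatom_pslStabilizer_dotHyperplane (hd : 2 ≤ d) {w : Fin d → F} (hw : w ≠ 0) :
    IsCoatom (pslStabilizer (dotHyperplane w)) := by
  rw [← map_pslInvTranspose]
  exact (OrderIso.isCoatom_iff (pslInvTranspose d F).mapSubgroup _).2
    (isCoatom_pslStabilizer_span_singleton hd hw)

/-- The transvection `x ↦ x + (f ⬝ᵥ x) • y`, as an element of `SL_d(F)`. -/
def slTransvection (f y : Fin d → F) (h : f ⬝ᵥ y = 0) : SpecialLinearGroup (Fin d) F :=
  ⟨1 + vecMulVec y f, by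
    rw [vecMulVec_eq Unit, det_one_add_replicateCol_mul_replicateRow, h, add_zero]⟩

theorem slTransvection_mulVec {f y : Fin d → F} (h : f ⬝ᵥ y = 0) (x : Fin d → F) :
    (slTransvection f y h).1 *ᵥ x = x + (f ⬝ᵥ x) • y := by
  rw [slTransvection, add_mulVec, one_mulVec, vecMulVec_mulVec, op_smul_eq_smul]

theorem slTransvection_mem_slStabilizer {f y : Fin d → F} (h : f ⬝ᵥ y = 0)
    {W : Submodule F (Fin d → F)} (hy : y ∈ W) : slTransvection f y h ∈ slStabilizer W :=
  mem_slStabilizer_iff.2 fun x hx ↦ by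
    rw [slTransvection_mulVec]
    exact add_mem hx (W.smul_mem _ hy)

theorem exists_dotProduct_eq_zero_and_ne_zero {u y : Fin d → F} (h : u ∉ Submodule.span F {y}) :
    ∃ f : Fin d → F, f ⬝ᵥ y = 0 ∧ f ⬝ᵥ u ≠ 0 := by
  obtain ⟨φ, hφu, hφy⟩ := Submodule.exists_le_ker_of_notMem h
  obtain ⟨f, rfl⟩ := (dotProductEquiv F (Fin d)).surjective φ
  exact ⟨f, hφy (Submodule.mem_span_singleton_self y), hφu⟩

theorem not_slStabilizer_le_slStabilizer_span_singleton {W : Submodule F (Fin d → F)}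
    (hW : 2 ≤ Module.finrank F W) {u : Fin d → F} (hu : u ≠ 0) :
    ¬ slStabilizer W ≤ slStabilizer (Submodule.span F {u}) := by
  intro h
  obtain ⟨y, hyW, hyu⟩ : ∃ y ∈ W, y ∉ Submodule.span F {u} := by
    by_contra! hle
    have := (Submodule.finrank_mono hle).trans_eq (finrank_span_singleton hu)
    lia
  have huy : u ∉ Submodule.span F {y} := by
    intro hmem
    obtain ⟨c, rfl⟩ := Submodule.mem_span_singleton.1 hmem
    rw [Submodule.span_singleton_smul_eq (smul_ne_zero_iff.1 hu).1.isUnit] at hyu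
    exact hyu (Submodule.mem_span_singleton_self y)
  obtain ⟨f, hfy, hfu⟩ := exists_dotProduct_eq_zero_and_ne_zero huy
  have hmem := mem_slStabilizer_iff.1 (h (slTransvection_mem_slStabilizer hfy hyW)) u
    (Submodule.mem_span_singleton_self u)
  rw [slTransvection_mulVec, Submodule.add_mem_iff_right _ (Submodule.mem_span_singleton_self u),
    Submodule.smul_mem_iff _ hfu] at hmem
  exact hyu hmem

theorem not_subgroupsConjugate_pslStabilizer {v : Fin d → F} (hv : v ≠ 0)
    {W : Submodule F (Fin d → F)} (hW : 2 ≤ Module.finrank F W) :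
    ¬ SubgroupsConjugate (pslStabilizer (Submodule.span F {v})) (pslStabilizer W) := by
  rintro ⟨x, hx⟩
  obtain ⟨g, rfl⟩ := QuotientGroup.mk'_surjective _ x
  rw [map_conj_pslStabilizer, Submodule.smul_span, Set.smul_set_singleton] at hx
  refine not_slStabilizer_le_slStabilizer_span_singleton hW
    ((smul_ne_zero_iff_ne g).2 hv) (le_of_eq ?_)
  rw [← comap_pslStabilizer, ← comap_pslStabilizer, hx]

end Maximality

section Gassmann

theorem SubgroupsConjugate.ncard_inter_eq {G : Type*} [Group G] {U V : Subgroup G}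
    (h : SubgroupsConjugate U V) (C : ConjClasses G) :
    (C.carrier ∩ (U : Set G)).ncard = (C.carrier ∩ (V : Set G)).ncard := by
  obtain ⟨g, rfl⟩ := h
  have hC (x : G) : MulAut.conj g x ∈ C.carrier ↔ x ∈ C.carrier := by
    rw [ConjClasses.mem_carrier_iff_mk_eq, ConjClasses.mem_carrier_iff_mk_eq,
      ← ConjClasses.mk_eq_mk_iff_isConj.2 (isConj_iff.2 ⟨g, rfl⟩ : IsConj x (MulAut.conj g x))]
  rw [← Set.ncard_image_of_injective _ (MulAut.conj g).injective]
  congr 1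
  ext y
  obtain ⟨x, rfl⟩ := (MulAut.conj g).surjective y
  simp [hC, -MulAut.conj_apply]

theorem sum_ncard_inter_eq {G X : Type*} [Group G] [Finite G] [Fintype X] (U : X → Subgroup G)
    (C : Set G) : ∑ p, (C ∩ (U p : Set G)).ncard =
      ∑ x ∈ C.toFinite.toFinset, Nat.card {p // x ∈ U p} := by
  classical
  convert Finset.sum_card_bipartiteAbove_eq_sum_card_bipartiteBelow (s := Finset.univ)
    (t := C.toFinite.toFinset) (fun p x ↦ x ∈ U p) with p _ x _
  · rw [← Set.ncard_coe_finset, Finset.coe_bipartiteAbove]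
    simp [Set.inter_def]
  · rw [Nat.card_eq_fintype_card, Fintype.card_subtype, Finset.bipartiteBelow]

/-- Both members of the conclusion are averages over `X`, which can be computed by summing over
the elements of a conjugacy class first. -/
theorem gassmannEquivalent_of_card_eq {G X : Type*} [Group G] [Finite G] [Finite X]
    (U V : X → Subgroup G) (hU : ∀ p q, SubgroupsConjugate (U p) (U q))
    (hV : ∀ p q, SubgroupsConjugate (V p) (V q))
    (h : ∀ x, Nat.card {p // x ∈ U p} = Nat.card {p // x ∈ V p}) (p q : X) :
    GassmannEquivalent (U p) (V q) := by
  have := Fintype.ofFinite X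
  have : Nonempty X := ⟨p⟩
  intro C
  refine Nat.eq_of_mul_eq_mul_left (Fintype.card_pos (α := X)) ?_
  calc Fintype.card X * (C.carrier ∩ (U p : Set G)).ncard
      = ∑ r, (C.carrier ∩ (U r : Set G)).ncard := by
        simp [(hU _ p).ncard_inter_eq C]
    _ = ∑ r, (C.carrier ∩ (V r : Set G)).ncard := by
        simp only [sum_ncard_inter_eq, h]
    _ = Fintype.card X * (C.carrier ∩ (V q : Set G)).ncard := by
        simp [(hV _ q).ncard_inter_eq C]

end Gassmann

section Eigenvectors

open Matrix Module.End
open scoped Pointwise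

theorem card_eigenvectors_eq {K V : Type*} [Field K] [AddCommGroup V] [Module K V]
    [FiniteDimensional K V] {f g : Module.End K V}
    (h : ∀ c, Module.finrank K (eigenspace f c) = Module.finrank K (eigenspace g c)) :
    Nat.card {v : {v : V // v ≠ 0} // ∃ c : K, f v = c • (v : V)} =
      Nat.card {v : {v : V // v ≠ 0} // ∃ c : K, g v = c • (v : V)} := by
  let eigenpairs (f : Module.End K V) : (Σ c : K, {v : eigenspace f c // v ≠ 0}) ≃
      {v : {v : V // v ≠ 0} // ∃ c : K, f v = c • (v : V)} :=
    Equiv.ofBijective (fun x ↦ ⟨⟨x.2.1.1, fun h ↦ x.2.2 (Subtype.ext h)⟩, x.1,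
        mem_eigenspace_iff.1 x.2.1.2⟩) <| by
      constructor
      · rintro ⟨c, ⟨⟨v, hv⟩, hv₀⟩⟩ ⟨c', ⟨⟨v', hv'⟩, hv₀'⟩⟩ h
        obtain rfl : v = v' := congrArg (fun x ↦ x.1.1) h
        obtain rfl : c = c' := smul_left_injective K (fun h ↦ hv₀ (Subtype.ext h))
          ((mem_eigenspace_iff.1 hv).symm.trans (mem_eigenspace_iff.1 hv'))
        rfl
      · rintro ⟨⟨v, hv₀⟩, c, hv⟩
        exact ⟨⟨c, ⟨⟨v, mem_eigenspace_iff.2 hv⟩, fun h ↦ hv₀ (congrArg Subtype.val h)⟩⟩, rfl⟩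
  refine Nat.card_congr ((eigenpairs f).symm.trans (.trans (Equiv.sigmaCongrRight fun c ↦ ?_)
    (eigenpairs g)))
  let e := LinearEquiv.ofFinrankEq _ _ (h c)
  exact e.toEquiv.subtypeEquiv fun v ↦ e.map_ne_zero_iff.symm

variable {d : ℕ} {F : Type*} [Field F]

theorem finrank_eigenspace_transpose (A : Matrix (Fin d) (Fin d) F) (c : F) :
    Module.finrank F (eigenspace (toLin' Aᵀ) c) = Module.finrank F (eigenspace (toLin' A) c) := by
  have rank_add_finrank (B : Matrix (Fin d) (Fin d) F) :
      (B - c • 1).rank + Module.finrank F (eigenspace (toLin' B) c) = d := by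
    rw [rank, ← toLin'_apply', map_sub, map_smul, toLin'_one, ← one_eq_id, eigenspace_def,
      LinearMap.finrank_range_add_finrank_ker, Module.finrank_fin_fun]
  have h : (Aᵀ - c • 1).rank = (A - c • 1).rank := by
    rw [← rank_transpose, transpose_sub, transpose_transpose, transpose_smul, transpose_one]
  have := rank_add_finrank A
  have := rank_add_finrank Aᵀ
  lia

theorem subgroupsConjugate_pslStabilizer_span_singleton {v w : Fin d → F} (hv : v ≠ 0)
    (hw : w ≠ 0) : SubgroupsConjugate (pslStabilizer (Submodule.span F {v}))
      (pslStabilizer (Submodule.span F {w})) := by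
  obtain ⟨g, hg⟩ := exists_smul_span_singleton_eq hv hw
  exact ⟨_, by rw [map_conj_pslStabilizer, hg]⟩

theorem SubgroupsConjugate.map_mulEquiv {G H : Type*} [Group G] [Group H] {U V : Subgroup G}
    (h : SubgroupsConjugate U V) (e : G ≃* H) :
    SubgroupsConjugate (U.map e.toMonoidHom) (V.map e.toMonoidHom) := by
  obtain ⟨g, rfl⟩ := h
  refine ⟨e g, ?_⟩
  rw [Subgroup.map_map, Subgroup.map_map]
  congr 1
  ext x
  simp

theorem subgroupsConjugate_pslStabilizer_dotHyperplane {v w : Fin d → F} (hv : v ≠ 0)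
    (hw : w ≠ 0) :
    SubgroupsConjugate (pslStabilizer (dotHyperplane v)) (pslStabilizer (dotHyperplane w)) := by
  rw [← map_pslInvTranspose, ← map_pslInvTranspose]
  exact (subgroupsConjugate_pslStabilizer_span_singleton hv hw).map_mulEquiv _

theorem gassmannEquivalent_pslStabilizer [Finite F] {v w : Fin d → F} (hv : v ≠ 0) (hw : w ≠ 0) :
    GassmannEquivalent (pslStabilizer (Submodule.span F {v}))
      (pslStabilizer (dotHyperplane w)) := by
  refine gassmannEquivalent_of_card_eq (X := {v : Fin d → F // v ≠ 0})
    (fun v ↦ pslStabilizer (Submodule.span F {v.1})) (fun w ↦ pslStabilizer (dotHyperplane w.1))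
    (fun v w ↦ subgroupsConjugate_pslStabilizer_span_singleton v.2 w.2)
    (fun v w ↦ subgroupsConjugate_pslStabilizer_dotHyperplane v.2 w.2) ?_ ⟨v, hv⟩ ⟨w, hw⟩
  intro x
  obtain ⟨A, rfl⟩ := QuotientGroup.mk'_surjective _ x
  simp only [mk_mem_pslStabilizer, mem_slStabilizer_span_singleton, mem_slStabilizer_dotHyperplane]
  exact card_eigenvectors_eq fun c ↦ (finrank_eigenspace_transpose A.1 c).symm

end Eigenvectors

section SylowConjugate

theorem sylowConjugate_of_card_eq {G : Type*} [Group G] [Finite G] {U V : Subgroup G}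
    (hcard : Nat.card U = Nat.card V)
    (h : ∀ p : ℕ, p.Prime → ∃ (P : Sylow p U) (g : G),
      ((P : Subgroup U).map U.subtype).map (MulAut.conj g).toMonoidHom ≤ V) :
    SylowConjugate U V := by
  intro p hp
  have : Fact p.Prime := ⟨hp⟩
  obtain ⟨P, g, hPg⟩ := h p hp
  set R := ((P : Subgroup U).map U.subtype).map (MulAut.conj g).toMonoidHom with hR
  have hRcard : Nat.card (R.subgroupOf V) = p ^ (Nat.card V).factorization p := by
    rw [Nat.card_congr (Subgroup.subgroupOfEquivOfLe hPg).toEquiv, hR,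
      Subgroup.card_map_of_injective (MulAut.conj g).injective,
      Subgroup.card_map_of_injective U.subtype_injective, ← hcard]
    exact P.card_eq_multiplicity
  exact ⟨P, Sylow.ofCard (R.subgroupOf V) hRcard, g, (Subgroup.map_subgroupOf_eq_of_le hPg).symm⟩

theorem exists_sylow_map {G G' : Type*} [Group G] [Group G'] [Finite G] (f : G →* G')
    {H : Subgroup G} {p : ℕ} [Fact p.Prime] (P : Sylow p H) :
    ∃ Q : Sylow p (H.map f), (Q : Subgroup (H.map f)).map (H.map f).subtype =
      ((P : Subgroup H).map H.subtype).map f := by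
  refine ⟨P.mapSurjective (f.subgroupMap_surjective H), ?_⟩
  rw [Sylow.coe_mapSurjective, Subgroup.map_map, Subgroup.map_map]
  rfl

open Matrix

variable {d : ℕ} {F : Type*} [Field F]

theorem exists_monoidHom_mulVec_eq_smul {v : Fin d → F} (hv : v ≠ 0)
    {P : Subgroup (SpecialLinearGroup (Fin d) F)} (hP : P ≤ slStabilizer (Submodule.span F {v})) :
    ∃ χ : P →* F, ∀ A : P, A.1.1 *ᵥ v = χ A • v := by
  choose χ hχ using fun A : P ↦ mem_slStabilizer_span_singleton.1 (hP A.2)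
  refine ⟨⟨⟨χ, ?_⟩, fun A B ↦ ?_⟩, hχ⟩ <;> apply smul_left_injective F hv <;> dsimp only
  · rw [← hχ, one_smul]
    exact one_mulVec v
  · rw [← hχ, mul_comm, mul_smul, ← hχ A, ← mulVec_smul, ← hχ B, mulVec_mulVec]
    rfl

/-- The eigenvector `w` is the average of `(χ A)⁻¹ Aᵀ f` over `P`, where `f ⬝ᵥ v = 1`; it is
nonzero as `w ⬝ᵥ v = |P|`. -/
theorem exists_transpose_mulVec_eq_smul {P : Subgroup (SpecialLinearGroup (Fin d) F)} [Finite P]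
    (hP : (Nat.card P : F) ≠ 0) {χ : P →* F} {v : Fin d → F} (hv : v ≠ 0)
    (hχ : ∀ A : P, A.1.1 *ᵥ v = χ A • v) :
    ∃ w : Fin d → F, w ≠ 0 ∧ ∀ A : P, A.1.1ᵀ *ᵥ w = χ A • w := by
  have := Fintype.ofFinite P
  obtain ⟨f, hf⟩ : ∃ f : Fin d → F, f ⬝ᵥ v = 1 := by
    obtain ⟨i, hi⟩ := Function.ne_iff.1 hv
    exact ⟨Pi.single i (v i)⁻¹, by rw [single_dotProduct, inv_mul_cancel₀ hi]⟩
  refine ⟨∑ A : P, χ A⁻¹ • (A.1.1ᵀ *ᵥ f), fun hw ↦ hP ?_, fun B ↦ ?_⟩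
  · calc (Nat.card P : F) = ∑ A : P, (χ A⁻¹ • (A.1.1ᵀ *ᵥ f)) ⬝ᵥ v := by
          rw [Nat.card_eq_fintype_card, ← Finset.card_univ, Finset.cast_card]
          refine Finset.sum_congr rfl fun A _ ↦ ?_
          rw [smul_dotProduct, mulVec_transpose, ← dotProduct_mulVec, hχ, dotProduct_smul, hf,
            smul_eq_mul, smul_eq_mul, mul_one, ← map_mul, inv_mul_cancel, map_one]
      _ = 0 := by rw [← sum_dotProduct, hw, zero_dotProduct]
  · rw [mulVec_sum, Finset.smul_sum]
    refine Fintype.sum_equiv (Equiv.mulRight B) _ _ fun A ↦ ?_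
    rw [Equiv.coe_mulRight, mulVec_smul, mulVec_mulVec, smul_smul, ← map_mul,
      _root_.mul_inv_rev, mul_inv_cancel_left, ← transpose_mul]
    rfl

theorem exists_le_slStabilizer_dotHyperplane_of_card_ne_zero {v : Fin d → F} (hv : v ≠ 0)
    {P : Subgroup (SpecialLinearGroup (Fin d) F)} [Finite P]
    (hP : P ≤ slStabilizer (Submodule.span F {v})) (hcard : (Nat.card P : F) ≠ 0) :
    ∃ w : Fin d → F, w ≠ 0 ∧ P ≤ slStabilizer (dotHyperplane w) := by
  obtain ⟨χ, hχ⟩ := exists_monoidHom_mulVec_eq_smul hv hP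
  obtain ⟨w, hw, hwχ⟩ := exists_transpose_mulVec_eq_smul hcard hv hχ
  exact ⟨w, hw, fun A hA ↦ mem_slStabilizer_dotHyperplane.2 ⟨χ ⟨A, hA⟩, hwχ ⟨A, hA⟩⟩⟩

theorem exists_le_slStabilizer_span_singleton_of_isPGroup [Finite F] (hd : d ≠ 0) {p : ℕ}
    [Fact p.Prime] [CharP F p] {P : Subgroup (SpecialLinearGroup (Fin d) F)} (hP : IsPGroup p P) :
    ∃ v : Fin d → F, v ≠ 0 ∧ P ≤ slStabilizer (Submodule.span F {v}) := by
  have := Fintype.ofFinite F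
  have hdvd : p ∣ Nat.card (Fin d → F) := by
    rw [Nat.card_fun, Nat.card_fin, Nat.card_eq_fintype_card]
    exact dvd_pow ((CharP.cast_eq_zero_iff F p _).1 (Nat.cast_card_eq_zero F)) hd
  obtain ⟨v, hv, hv₀⟩ := hP.exists_fixed_point_of_prime_dvd_card_of_fixed_point (Fin d → F) hdvd
    (a := 0) (fun A ↦ smul_zero A)
  exact ⟨v, hv₀.symm, fun A hA ↦ mem_slStabilizer_span_singleton.2
    ⟨1, (hv ⟨A, hA⟩).trans (one_smul F v).symm⟩⟩

theorem exists_le_slStabilizer_dotHyperplane_of_isPGroup_of_charP [Finite F] (hd : d ≠ 0) {p : ℕ}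
    [Fact p.Prime] [CharP F p] {P : Subgroup (SpecialLinearGroup (Fin d) F)} (hP : IsPGroup p P) :
    ∃ w : Fin d → F, w ≠ 0 ∧ P ≤ slStabilizer (dotHyperplane w) := by
  obtain ⟨w, hw, hle⟩ :=
    exists_le_slStabilizer_span_singleton_of_isPGroup hd (hP.map (slInvTranspose d F).toMonoidHom)
  refine ⟨w, hw, fun A hA ↦ ?_⟩
  rw [← (slInvTranspose d F).apply_symm_apply A, slInvTranspose_mem_slStabilizer_dotHyperplane]
  exact hle ⟨A, hA, rfl⟩

theorem exists_le_slStabilizer_dotHyperplane_of_isPGroup [Finite F] {p : ℕ} [Fact p.Prime]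
    {P : Subgroup (SpecialLinearGroup (Fin d) F)} (hP : IsPGroup p P) {v : Fin d → F}
    (hv : v ≠ 0) (hPv : P ≤ slStabilizer (Submodule.span F {v})) :
    ∃ w : Fin d → F, w ≠ 0 ∧ P ≤ slStabilizer (dotHyperplane w) := by
  by_cases hpF : (p : F) = 0
  · have : CharP F p := (CharP.charP_iff_prime_eq_zero Fact.out).2 hpF
    have hd : d ≠ 0 := by
      rintro rfl
      exact hv (Subsingleton.elim _ _)
    exact exists_le_slStabilizer_dotHyperplane_of_isPGroup_of_charP hd hP
  · obtain ⟨n, hn⟩ := IsPGroup.iff_card.1 hP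
    refine exists_le_slStabilizer_dotHyperplane_of_card_ne_zero hv hPv ?_
    rw [hn, Nat.cast_pow]
    exact pow_ne_zero n hpF

theorem sylowConjugate_pslStabilizer [Finite F] {v w : Fin d → F} (hv : v ≠ 0) (hw : w ≠ 0) :
    SylowConjugate (pslStabilizer (Submodule.span F {v})) (pslStabilizer (dotHyperplane w)) := by
  obtain ⟨φ, hφ⟩ := exists_mulAut_map_pslStabilizer_span_eq hv hw
  refine sylowConjugate_of_card_eq ?_ fun p hp ↦ ?_
  · rw [← hφ, Subgroup.card_map_of_injective φ.injective]
  have : Fact p.Prime := ⟨hp⟩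
  obtain ⟨P⟩ : Nonempty (Sylow p (slStabilizer (Submodule.span F {v}))) := inferInstance
  obtain ⟨w', hw', hle⟩ := exists_le_slStabilizer_dotHyperplane_of_isPGroup
    (P.2.map (Subgroup.subtype _)) hv (Subgroup.map_subtype_le _)
  obtain ⟨g, hg⟩ := subgroupsConjugate_pslStabilizer_dotHyperplane hw' hw
  obtain ⟨Q, hQ⟩ := exists_sylow_map (QuotientGroup.mk' (Subgroup.center _)) P
  refine ⟨Q, g, ?_⟩
  rw [← hg]
  exact Subgroup.map_mono (hQ.trans_le (Subgroup.map_mono hle))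

end SylowConjugate

section ProfiniteSylow

variable {H : Type*} [Group H] [TopologicalSpace H]

/-- A closed subgroup of a profinite group whose (supernatural) index is prime to `p`, as read off
in the finite quotients; the minimal ones are the `p`-Sylow subgroups. -/
def HasIndexPrimeTo (p : ℕ) (S : Subgroup H) : Prop :=
  IsClosed (S : Set H) ∧ ∀ (N : Subgroup H) [N.Normal], IsOpen (N : Set H) →
    ¬ p ∣ (S.map (QuotientGroup.mk' N)).index

theorem hasIndexPrimeTo_top {p : ℕ} (hp : p.Prime) :
    HasIndexPrimeTo p (⊤ : Subgroup H) := by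
  refine ⟨isClosed_univ, fun N _ _ ↦ ?_⟩
  rw [Subgroup.map_top_of_surjective _ (QuotientGroup.mk'_surjective N), Subgroup.index_top]
  exact hp.not_dvd_one

theorem IsProfiniteSylow.map {A : Type*} [Group A] [TopologicalSpace A] [CompactSpace A]
    [T2Space H] {p : ℕ} (hp : p.Prime) {T : Subgroup A} (hT : IsProfiniteSylow p T) {f : A →* H}
    (hf : Continuous f) (hind : ¬ p ∣ f.range.index) : IsProfiniteSylow p (T.map f) := by
  refine ⟨hf.isClosedMap _ hT.1, fun N _ hN ↦ ?_⟩
  let φ : A ⧸ N.comap f →* H ⧸ N := QuotientGroup.map (N.comap f) N f le_rfl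
  have hφ : (QuotientGroup.mk' N).comp f = φ.comp (QuotientGroup.mk' (N.comap f)) := rfl
  have hrange : φ.range = f.range.map (QuotientGroup.mk' N) := by
    rw [← MonoidHom.range_comp, hφ, MonoidHom.range_comp, QuotientGroup.range_mk',
      MonoidHom.range_eq_map]
  obtain ⟨hpgroup, hindex⟩ := hT.2 (N.comap f) (hN.preimage hf)
  rw [Subgroup.map_map, hφ, ← Subgroup.map_map]
  refine ⟨hpgroup.map φ, fun hdvd ↦ ?_⟩
  rw [Subgroup.index_map, hrange, hp.dvd_mul] at hdvd
  exact hdvd.elim (fun h ↦ hindex (h.trans (Subgroup.index_dvd_of_le le_sup_left)))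
    fun h ↦ hind (h.trans (Subgroup.index_map_dvd _ (QuotientGroup.mk'_surjective N)))

theorem HasIndexPrimeTo.map_subtype [IsTopologicalGroup H] {p : ℕ} (hp : p.Prime) {S : Subgroup H}
    (hS : HasIndexPrimeTo p S) {A : Subgroup S} (hA : IsOpen (A : Set S)) (hpA : ¬ p ∣ A.index) :
    HasIndexPrimeTo p (A.map S.subtype) := by
  refine ⟨hS.1.isClosedMap_subtype_val _ (Subgroup.isClosed_of_isOpen A hA), fun N _ hN hdvd ↦ ?_⟩
  rw [Subgroup.map_map, Subgroup.index_map, MonoidHom.range_comp, Subgroup.range_subtype,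
    hp.dvd_mul] at hdvd
  exact hdvd.elim (fun h ↦ hpA (h.trans (Subgroup.index_dvd_of_le le_sup_left))) (hS.2 N hN)

variable [CompactSpace H]

theorem nonempty_sInf_inter_of_isChain {c : Set (Subgroup H)} (hc : IsChain (· ≤ ·) c)
    (hne : c.Nonempty) (hcl : ∀ S ∈ c, IsClosed (S : Set H)) {K : Set H} (hK : IsClosed K)
    (hcK : ∀ S ∈ c, ((S : Set H) ∩ K).Nonempty) : ((sInf c : Subgroup H) ∩ K : Set H).Nonempty := by
  have : Nonempty c := hne.to_subtype
  have hdir : Directed (· ⊇ ·) fun S : c ↦ ((S : Subgroup H) : Set H) ∩ K :=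
    fun S T ↦ (hc.total S.2 T.2).elim
      (fun h ↦ ⟨S, subset_rfl, Set.inter_subset_inter_left K h⟩)
      (fun h ↦ ⟨T, Set.inter_subset_inter_left K h, subset_rfl⟩)
  have hclK (S : c) : IsClosed (((S : Subgroup H) : Set H) ∩ K) := (hcl S S.2).inter hK
  obtain ⟨y, hy⟩ := IsCompact.nonempty_iInter_of_directed_nonempty_isCompact_isClosed
    _ hdir (fun S ↦ hcK S S.2) (fun S ↦ (hclK S).isCompact) hclK
  rw [Set.mem_iInter] at hy
  exact ⟨y, Subgroup.mem_sInf.2 fun S hS ↦ (hy ⟨S, hS⟩).1, (hy ⟨_, hne.some_mem⟩).2⟩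

variable [IsTopologicalGroup H]

theorem exists_map_mk_le_map_sInf {c : Set (Subgroup H)} (hc : IsChain (· ≤ ·) c)
    (hne : c.Nonempty) (hcl : ∀ S ∈ c, IsClosed (S : Set H)) (N : Subgroup H) [N.Normal]
    (hN : IsOpen (N : Set H)) :
    ∃ S ∈ c, S.map (QuotientGroup.mk' N) ≤ (sInf c).map (QuotientGroup.mk' N) := by
  have : Finite (H ⧸ N) := Subgroup.quotient_finite_of_isOpen N hN
  obtain ⟨S, hS, hmin⟩ := exists_minimalFor_of_wellFoundedLT (· ∈ c)
    (fun S ↦ S.map (QuotientGroup.mk' N)) hne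
  refine ⟨S, hS, ?_⟩
  rintro _ ⟨x, hx, rfl⟩
  have hle : ∀ T ∈ c, S.map (QuotientGroup.mk' N) ≤ T.map (QuotientGroup.mk' N) := fun T hT ↦
    (hc.total hS hT).elim Subgroup.map_mono fun h ↦ hmin hT (Subgroup.map_mono h)
  have hcoset : IsClosed ((x⁻¹ * ·) ⁻¹' (N : Set H)) :=
    (Subgroup.isClosed_of_isOpen N hN).preimage (continuous_const_mul x⁻¹)
  obtain ⟨y, hy, hxy⟩ := nonempty_sInf_inter_of_isChain hc hne hcl hcoset fun T hT ↦ by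
    obtain ⟨y, hy, hxy⟩ := hle T hT ⟨x, hx, rfl⟩
    exact ⟨y, hy, QuotientGroup.eq.1 hxy.symm⟩
  exact ⟨y, hy, (QuotientGroup.eq.2 hxy).symm⟩

theorem hasIndexPrimeTo_sInf_of_isChain {p : ℕ} {c : Set (Subgroup H)} (hc : IsChain (· ≤ ·) c)
    (hne : c.Nonempty) (h : ∀ S ∈ c, HasIndexPrimeTo p S) : HasIndexPrimeTo p (sInf c) := by
  refine ⟨?_, fun N _ hN hdvd ↦ ?_⟩
  · rw [Subgroup.coe_sInf]
    exact isClosed_biInter fun S hS ↦ (h S hS).1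
  · obtain ⟨S, hS, hle⟩ := exists_map_mk_le_map_sInf hc hne (fun S hS ↦ (h S hS).1) N hN
    exact (h S hS).2 N hN (hdvd.trans (Subgroup.index_dvd_of_le hle))

theorem exists_minimal_hasIndexPrimeTo {p : ℕ} (hp : p.Prime) :
    ∃ S : Subgroup H, Minimal (HasIndexPrimeTo p) S := by
  obtain ⟨S, -, hS⟩ := zorn_le_nonempty₀ (α := (Subgroup H)ᵒᵈ) {S | HasIndexPrimeTo p S}
    (fun (c : Set (Subgroup H)) hc hchain S hS ↦ ⟨(sInf c : Subgroup H),
      hasIndexPrimeTo_sInf_of_isChain hchain.symm ⟨S, hS⟩ hc,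
      fun _ hT ↦ sInf_le (α := Subgroup H) hT⟩)
    (⊤ : Subgroup H) (hasIndexPrimeTo_top hp)
  exact ⟨S, hS⟩

theorem isProfiniteSylow_of_minimal {p : ℕ} (hp : p.Prime) {S : Subgroup H}
    (hS : Minimal (HasIndexPrimeTo p) S) : IsProfiniteSylow p S := by
  refine ⟨hS.prop.1, fun N _ hN ↦ ⟨?_, hS.prop.2 N hN⟩⟩
  have : Fact p.Prime := ⟨hp⟩
  have : Finite (H ⧸ N) := Subgroup.quotient_finite_of_isOpen N hN
  let f := (QuotientGroup.mk' N).subgroupMap S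
  have hf : Function.Surjective f := (QuotientGroup.mk' N).subgroupMap_surjective S
  let T : Sylow p (S.map (QuotientGroup.mk' N)) := default
  have hindex : ¬ p ∣ ((T : Subgroup _).comap f).index := by
    rw [Subgroup.index_comap_of_surjective _ hf]
    exact T.not_dvd_index
  have hker : N.subgroupOf S ≤ (T : Subgroup _).comap f := by
    refine le_trans (fun x hx ↦ ?_) (MonoidHom.ker_le_comap f (T : Subgroup _))
    exact Subtype.ext ((QuotientGroup.eq_one_iff (x : H)).2 hx)
  have hopen : IsOpen ((T : Subgroup _).comap f : Set S) :=
    Subgroup.isOpen_mono hker (hN.preimage continuous_subtype_val)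
  have hle := hS.le_of_le (hS.prop.map_subtype hp hopen hindex) (Subgroup.map_subtype_le _)
  have hT : (T : Subgroup (S.map (QuotientGroup.mk' N))) = ⊤ := by
    refine eq_top_iff.2 fun y _ ↦ ?_
    obtain ⟨x, rfl⟩ := hf y
    obtain ⟨z, hz, hzx⟩ := hle x.2
    rwa [Subtype.ext hzx] at hz
  have h := T.isPGroup'
  rw [hT] at h
  exact h.of_equiv Subgroup.topEquiv

theorem exists_isProfiniteSylow {p : ℕ} (hp : p.Prime) : ∃ S : Subgroup H, IsProfiniteSylow p S :=
  (exists_minimal_hasIndexPrimeTo hp).imp fun _ ↦ isProfiniteSylow_of_minimal hp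

end ProfiniteSylow

theorem map_conj_comap {Γ G : Type*} [Group Γ] [Group G] (π : Γ →* G) (K : Subgroup G) (γ : Γ) :
    (K.comap π).map (MulAut.conj γ).toMonoidHom =
      (K.map (MulAut.conj (π γ)).toMonoidHom).comap π := by
  rw [Subgroup.map_equiv_eq_comap_symm', Subgroup.map_equiv_eq_comap_symm', Subgroup.comap_comap,
    Subgroup.comap_comap]
  congr 1
  ext x
  simp

theorem not_dvd_relIndex_comap_sylow {Γ G : Type*} [Group Γ] [Group G] [Finite G] {π : Γ →* G}
    (hπ : Function.Surjective π) {p : ℕ} [Fact p.Prime] {W : Subgroup G} (R : Sylow p W) :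
    ¬ p ∣ (((R : Subgroup W).map W.subtype).comap π).relIndex (W.comap π) := by
  rw [Subgroup.relIndex_comap, Subgroup.map_comap_eq_self_of_surjective hπ, Subgroup.relIndex,
    Subgroup.subgroupOf, Subgroup.comap_map_eq_self_of_injective W.subtype_injective]
  exact R.not_dvd_index

section TopologicalGroup

variable {Γ : Type*} [Group Γ] [TopologicalSpace Γ] [T2Space Γ]

theorem IsProfiniteSylow.map_inclusion {p : ℕ} (hp : p.Prime) {A B : Subgroup Γ} [CompactSpace A]
    (hAB : A ≤ B) (hind : ¬ p ∣ A.relIndex B) {T : Subgroup A} (hT : IsProfiniteSylow p T) :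
    IsProfiniteSylow p (T.map (Subgroup.inclusion hAB)) := by
  refine hT.map hp (continuous_subtype_val.subtype_mk _) ?_
  rwa [Subgroup.inclusion_range]

variable [IsTopologicalGroup Γ]

theorem IsProfiniteSylow.map_conj {p : ℕ} (hp : p.Prime) {A : Subgroup Γ} [CompactSpace A]
    {T : Subgroup A} (hT : IsProfiniteSylow p T) (γ : Γ) :
    IsProfiniteSylow p (T.map ((MulAut.conj γ).toMonoidHom.subgroupMap A)) := by
  refine hT.map hp
    (((continuous_const.mul continuous_subtype_val).mul continuous_const).subtype_mk _) ?_
  rw [MonoidHom.range_eq_top.2 (MonoidHom.subgroupMap_surjective _ A), Subgroup.index_top]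
  exact hp.not_dvd_one

theorem SylowConjugate.comap [CompactSpace Γ] {G : Type*} [Group G] [Finite G] {U V : Subgroup G}
    (h : SylowConjugate U V) {π : Γ →* G} (hπ : Function.Surjective π)
    (hker : IsOpen (π.ker : Set Γ)) : ProfiniteSylowConjugate (U.comap π) (V.comap π) := by
  intro p hp
  have : Fact p.Prime := ⟨hp⟩
  obtain ⟨P, Q, g, hg⟩ := h p hp
  obtain ⟨γ, rfl⟩ := hπ g
  let A : Subgroup Γ := ((P : Subgroup U).map U.subtype).comap π
  have hA : IsOpen (A : Set Γ) := Subgroup.isOpen_mono (MonoidHom.ker_le_comap π _) hker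
  have hAγ : A.map (MulAut.conj γ).toMonoidHom = ((Q : Subgroup V).map V.subtype).comap π := by
    rw [map_conj_comap, hg]
  have : CompactSpace A := isCompact_iff_compactSpace.1 (Subgroup.isClosed_of_isOpen A hA).isCompact
  have : CompactSpace (A.map (MulAut.conj γ).toMonoidHom) :=
    isCompact_iff_compactSpace.1 (hAγ ▸ (Subgroup.isClosed_of_isOpen _ (Subgroup.isOpen_mono
      (MonoidHom.ker_le_comap π _) hker)).isCompact)
  have hAU : A ≤ U.comap π := Subgroup.comap_mono (Subgroup.map_subtype_le _)
  have hAV : A.map (MulAut.conj γ).toMonoidHom ≤ V.comap π :=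
    hAγ.trans_le (Subgroup.comap_mono (Subgroup.map_subtype_le _))
  obtain ⟨T, hT⟩ := exists_isProfiniteSylow (H := A) hp
  refine ⟨T.map (Subgroup.inclusion hAU),
    (T.map ((MulAut.conj γ).toMonoidHom.subgroupMap A)).map (Subgroup.inclusion hAV),
    hT.map_inclusion hp hAU (not_dvd_relIndex_comap_sylow hπ P),
    (hT.map_conj hp γ).map_inclusion hp hAV ?_, γ, ?_⟩
  · rw [hAγ]
    exact not_dvd_relIndex_comap_sylow hπ Q
  · simp only [Subgroup.map_map]
    rfl

end TopologicalGroup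

theorem SylowConjugate.map {G G' : Type*} [Group G] [Group G'] [Finite G] {U V : Subgroup G}
    (h : SylowConjugate U V) (f : G →* G') : SylowConjugate (U.map f) (V.map f) := by
  intro p hp
  have : Fact p.Prime := ⟨hp⟩
  obtain ⟨P, Q, g, hg⟩ := h p hp
  obtain ⟨P₁, hP⟩ := exists_sylow_map f P
  obtain ⟨Q₁, hQ⟩ := exists_sylow_map f Q
  have hf : (MulAut.conj (f g)).toMonoidHom.comp f = f.comp (MulAut.conj g).toMonoidHom := by
    ext x
    simp
  refine ⟨P₁, Q₁, f g, ?_⟩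
  rw [hP, hQ, ← hg, Subgroup.map_map, hf, ← Subgroup.map_map]

theorem SylowConjugate.map_conj_right {G : Type*} [Group G] [Finite G] {U V : Subgroup G}
    (h : SylowConjugate U V) (g : G) :
    SylowConjugate U (V.map (MulAut.conj g).toMonoidHom) := by
  intro p hp
  have : Fact p.Prime := ⟨hp⟩
  obtain ⟨P, Q, x, hx⟩ := h p hp
  obtain ⟨Q₁, hQ⟩ := exists_sylow_map (MulAut.conj g).toMonoidHom Q
  refine ⟨P, Q₁, g * x, ?_⟩
  rw [hQ, ← hx, map_mul]
  simp only [Subgroup.map_map]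
  rfl

section Galois

variable {k M Ω : Type*} [Field k] [Field M] [Field Ω] [Algebra k M] [Algebra k Ω]

theorem profiniteSylowConjugate_map_fixingSubgroup_of_isScalarTower [FiniteDimensional k M]
    [IsGalois k M] [IsGalois k Ω] [Algebra M Ω] [IsScalarTower k M Ω] {K L : IntermediateField k M}
    (h : SylowConjugate K.fixingSubgroup L.fixingSubgroup) :
    ProfiniteSylowConjugate (K.map (IsScalarTower.toAlgHom k M Ω)).fixingSubgroup
      (L.map (IsScalarTower.toAlgHom k M Ω)).fixingSubgroup := by
  have : T2Space Gal(Ω/k) := krullTopology_t2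
  have hker : IsOpen ((AlgEquiv.restrictNormalHom (F := k) (K₁ := Ω) M).ker : Set Gal(Ω/k)) := by
    have : FiniteDimensional k ((⊤ : IntermediateField k M).map (IsScalarTower.toAlgHom k M Ω)) :=
      Module.Finite.equiv (IntermediateField.equivMap ⊤ _).toLinearEquiv
    rw [← MonoidHom.comap_bot, ← IntermediateField.fixingSubgroup_top,
      ← IntermediateField.map_fixingSubgroup]
    exact IntermediateField.fixingSubgroup_isOpen _
  rw [IntermediateField.map_fixingSubgroup, IntermediateField.map_fixingSubgroup]
  exact h.comap (AlgEquiv.restrictNormalHom_surjective Ω) hker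

theorem profiniteSylowConjugate_map_fixingSubgroup [FiniteDimensional k M] [IsGalois k M]
    [IsGalois k Ω] {K L : IntermediateField k M}
    (h : SylowConjugate K.fixingSubgroup L.fixingSubgroup) (σ τ : M →ₐ[k] Ω) :
    ProfiniteSylowConjugate (K.map σ).fixingSubgroup (L.map τ).fixingSubgroup := by
  let : Algebra M Ω := σ.toRingHom.toAlgebra
  have : IsScalarTower k M Ω := IsScalarTower.of_algebraMap_eq fun x ↦ (σ.commutes x).symm
  let g : Gal(M/k) := τ.restrictNormal' M
  have hτ : τ = σ.comp g.toAlgHom := AlgHom.ext fun x ↦ (τ.restrictNormal_commutes M x).symm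
  have hg : SylowConjugate K.fixingSubgroup (L.map g.toAlgHom).fixingSubgroup := by
    rw [IsGalois.map_fixingSubgroup]
    exact h.map_conj_right g
  rw [hτ, ← IntermediateField.map_map]
  exact profiniteSylowConjugate_map_fixingSubgroup_of_isScalarTower hg

theorem subgroupsConjugate_fixingSubgroup_of_algEquiv [Normal k M] {K L : IntermediateField k M}
    (f : K ≃ₐ[k] L) : SubgroupsConjugate K.fixingSubgroup L.fixingSubgroup := by
  have hmap : K.map (f.liftNormal M).toAlgHom = L := by
    rw [← IntermediateField.fieldRange_comp_val]
    ext x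
    constructor
    · rintro ⟨y, rfl⟩
      exact (f.liftNormal_commutes M y).symm ▸ (f y).2
    · exact fun hx ↦ ⟨f.symm ⟨x, hx⟩, (f.liftNormal_commutes M _).trans (by simp)⟩
  exact ⟨f.liftNormal M, (IsGalois.map_fixingSubgroup K (f.liftNormal M)).symm.trans
    (congrArg IntermediateField.fixingSubgroup hmap)⟩

theorem exists_fieldRange_eq_map [Algebra.IsAlgebraic k M] [IsAlgClosed Ω]
    {K : IntermediateField k M} (σ : K →ₐ[k] Ω) : ∃ ρ : M →ₐ[k] Ω, σ.fieldRange = K.map ρ := by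
  obtain ⟨ρ, rfl⟩ := IsAlgClosed.surjective_domRestrict_of_isAlgebraic (E := M) σ
  exact ⟨ρ, IntermediateField.fieldRange_comp_val K ρ⟩

end Galois

section NumberField

/-- Here `K` and `Ω` may carry any `ℚ`-algebra structures, as the instances found for
`NumberField.SylowConjugate` are not syntactically those inherited from `M` and `ℚ`. -/
theorem exists_fieldRange_eq_map_rat {M Ω : Type*} [Field M] [Field Ω] [Algebra ℚ M]
    [Algebra.IsAlgebraic ℚ M] [Algebra ℚ Ω] [IsAlgClosed Ω] {K : IntermediateField ℚ M}
    [Algebra ℚ K] (σ : K →ₐ[ℚ] Ω) : ∃ ρ : M →ₐ[ℚ] Ω, σ.fieldRange = K.map ρ := by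
  obtain rfl : ‹Algebra ℚ K› = K.algebra' := Subsingleton.elim _ _
  exact exists_fieldRange_eq_map σ

theorem numberField_sylowConjugate_of_fixingSubgroup {M : Type*} [Field M] [NumberField M]
    [IsGalois ℚ M] {K L : IntermediateField ℚ M}
    (h : SylowConjugate K.fixingSubgroup L.fixingSubgroup) : NumberField.SylowConjugate K L := by
  intro σ τ
  obtain ⟨σ', hσ⟩ := exists_fieldRange_eq_map_rat σ
  obtain ⟨τ', hτ⟩ := exists_fieldRange_eq_map_rat τ
  rw [hσ, hτ]
  have : IsAlgClosure ℚ (AlgebraicClosure ℚ) := by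
    convert! AlgebraicClosure.instIsAlgClosure ℚ
  have : IsGalois ℚ (AlgebraicClosure ℚ) := IsAlgClosure.isGalois _ _
  exact profiniteSylowConjugate_map_fixingSubgroup h σ' τ'

theorem isEmpty_ringEquiv_of_not_subgroupsConjugate {M : Type*} [Field M] [CharZero M]
    [IsGalois ℚ M] {K L : IntermediateField ℚ M}
    (h : ¬ SubgroupsConjugate K.fixingSubgroup L.fixingSubgroup) : IsEmpty (K ≃+* L) :=
  ⟨fun f ↦ h (subgroupsConjugate_fixingSubgroup_of_algEquiv f.toRatAlgEquiv)⟩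

end NumberField

section FixedPoints

variable {G U X Y : Type*} [Group G] [Group U]

theorem card_smul_eq_mul_ncard_orbit [MulAction U Y] {y y' : Y} (h : y' ∈ MulAction.orbit U y) :
    Nat.card {u : U // u • y = y'} * (MulAction.orbit U y).ncard = Nat.card U := by
  obtain ⟨g, rfl⟩ := h
  rw [← MulAction.index_stabilizer, ← (MulAction.stabilizer U y).card_mul_index]
  congr 1
  refine Nat.card_congr ((Equiv.mulLeft g⁻¹).subtypeEquiv fun u ↦ ?_)
  rw [MulAction.mem_stabilizer_iff, Equiv.coe_mulLeft, mul_smul, inv_smul_eq_iff]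

theorem card_sigma_smul_eq [MulAction U Y] [Finite U] [Finite Y] {r : Y → X}
    (hr : ∀ y y', r y = r y' ↔ ∃ u : U, u • y = y') {F : Y → Y} {y₀ : Y}
    (hF : ∀ y, r y = r y₀ → r (F y) = r y₀) :
    Nat.card (Σ y : {y // r y = r y₀}, {u : U // u • (y : Y) = F y}) = Nat.card U := by
  have := Fintype.ofFinite {y // r y = r y₀}
  have horbit (y : {y // r y = r y₀}) :
      (MulAction.orbit U (y : Y)).ncard = Nat.card {y // r y = r y₀} := by
    rw [← Nat.card_coe_set_eq]
    exact Nat.card_congr (Equiv.subtypeEquivRight fun z ↦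
      ⟨fun h ↦ ((hr _ _).2 h).symm.trans y.2, fun h ↦ (hr _ _).1 (y.2.trans h.symm)⟩)
  have hcard (y : {y // r y = r y₀}) : Nat.card {u : U // u • (y : Y) = F y} *
      Nat.card {y // r y = r y₀} = Nat.card U := by
    rw [← horbit y]
    exact card_smul_eq_mul_ncard_orbit ((hr _ _).1 (y.2.trans (hF y y.2).symm))
  have : Nonempty {y // r y = r y₀} := ⟨⟨y₀, rfl⟩⟩
  refine Nat.eq_of_mul_eq_mul_right (Nat.card_pos (α := {y // r y = r y₀})) ?_
  rw [Nat.card_sigma, Finset.sum_mul, Finset.sum_congr rfl fun y _ ↦ hcard y, Finset.sum_const,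
    Finset.card_univ, ← Nat.card_eq_fintype_card, smul_eq_mul, mul_comm]

/-- For `F = id` this is the Cauchy–Frobenius count of orbits. -/
theorem card_fixedPoints_mul_card [MulAction U Y] [Fintype U] [Finite Y] {r : Y → X}
    (hs : Function.Surjective r) (hr : ∀ y y', r y = r y' ↔ ∃ u : U, u • y = y')
    {F : Y → Y} {Φ : X → X} (hF : ∀ y, r (F y) = Φ (r y)) :
    Nat.card {x // Φ x = x} * Nat.card U = ∑ u : U, Nat.card {y // F y = u • y} := by
  have := Finite.of_surjective r hs
  have := Fintype.ofFinite {x // Φ x = x}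
  have hfiber (x : {x // Φ x = x}) :
      Nat.card (Σ y : {y // r y = x}, {u : U // u • (y : Y) = F y}) = Nat.card U := by
    obtain ⟨x, hx⟩ := x
    obtain ⟨y, rfl⟩ := hs x
    exact card_sigma_smul_eq hr fun z hz ↦ by rw [hF, hz, hx]
  have hrF {y : Y} {u : U} (h : F y = u • y) : Φ (r y) = r y := by
    rw [← hF, h, eq_comm, hr]
    exact ⟨u, rfl⟩
  calc Nat.card {x // Φ x = x} * Nat.card U
      = Nat.card (Σ (x : {x // Φ x = x}) (y : {y // r y = x}), {u : U // u • (y : Y) = F y}) := by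
        rw [Nat.card_sigma, Finset.sum_congr rfl fun x _ ↦ hfiber x, Finset.sum_const,
          Finset.card_univ, ← Nat.card_eq_fintype_card, smul_eq_mul]
    _ = Nat.card (Σ u : U, {y // F y = u • y}) := Nat.card_congr
        { toFun := fun a ↦ ⟨a.2.2, a.2.1, a.2.2.2.symm⟩
          invFun := fun b ↦ ⟨⟨r b.2, hrF b.2.2⟩, ⟨b.2, rfl⟩, b.1, b.2.2.symm⟩
          left_inv := by
            rintro ⟨⟨_, _⟩, ⟨y, hy⟩, u, _⟩
            cases hy
            rfl
          right_inv := fun _ ↦ rfl }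
    _ = ∑ u : U, Nat.card {y // F y = u • y} := Nat.card_sigma

theorem sum_eq_sum_conjClasses [Fintype (ConjClasses G)] (W : Subgroup G) [Fintype W]
    (c : ConjClasses G → ℕ) :
    ∑ w : W, c (ConjClasses.mk w) = ∑ C, (C.carrier ∩ (W : Set G)).ncard * c C := by
  classical
  rw [← Finset.sum_fiberwise (g := fun w : W ↦ ConjClasses.mk (w : G))]
  refine Finset.sum_congr rfl fun C _ ↦ ?_
  rw [Finset.sum_congr rfl fun w hw ↦ congrArg c (Finset.mem_filter.1 hw).2, Finset.sum_const,
    smul_eq_mul, ← Set.ncard_coe_finset, ← Set.ncard_image_of_injective _ Subtype.val_injective]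
  congr 2
  ext g
  simp [ConjClasses.mem_carrier_iff_mk_eq, and_comm]

namespace GassmannEquivalent

variable [Finite G] {U V : Subgroup G}

theorem sum_eq (h : GassmannEquivalent U V) [Fintype U] [Fintype V] {c : G → ℕ}
    (hc : ∀ a b, IsConj a b → c a = c b) : ∑ u : U, c u = ∑ v : V, c v := by
  have := Fintype.ofFinite (ConjClasses G)
  have hU := sum_eq_sum_conjClasses U (Quotient.lift c hc)
  have hV := sum_eq_sum_conjClasses V (Quotient.lift c hc)
  exact hU.trans ((Finset.sum_congr rfl fun C _ ↦ by rw [h C]).trans hV.symm)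

theorem card_eq (h : GassmannEquivalent U V) : Nat.card U = Nat.card V := by
  have := Fintype.ofFinite U
  have := Fintype.ofFinite V
  simpa [Nat.card_eq_fintype_card] using h.sum_eq (c := fun _ ↦ 1) fun _ _ _ ↦ rfl

theorem card_fixedPoints_eq (h : GassmannEquivalent U V) [MulAction G Y] [Finite Y] {X' : Type*}
    {r : Y → X} {r' : Y → X'} (hs : Function.Surjective r) (hs' : Function.Surjective r')
    (hr : ∀ y y', r y = r y' ↔ ∃ u : U, u • y = y')
    (hr' : ∀ y y', r' y = r' y' ↔ ∃ v : V, v • y = y')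
    {F : Y → Y} (hFG : ∀ (g : G) y, F (g • y) = g • F y) {Φ : X → X} {Φ' : X' → X'}
    (hF : ∀ y, r (F y) = Φ (r y)) (hF' : ∀ y, r' (F y) = Φ' (r' y)) :
    Nat.card {x // Φ x = x} = Nat.card {x // Φ' x = x} := by
  have := Fintype.ofFinite U
  have := Fintype.ofFinite V
  have hc (a b : G) (hab : IsConj a b) :
      Nat.card {y // F y = a • y} = Nat.card {y // F y = b • y} := by
    obtain ⟨g, rfl⟩ := isConj_iff.1 hab
    refine Nat.card_congr ((MulAction.toPerm g).subtypeEquiv fun y ↦ ?_)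
    rw [MulAction.toPerm_apply, hFG, smul_smul, inv_mul_cancel_right, mul_smul,
      (MulAction.injective g).eq_iff]
  refine Nat.eq_of_mul_eq_mul_right (Nat.card_pos (α := U)) ?_
  rw [card_fixedPoints_mul_card hs hr hF, h.card_eq, card_fixedPoints_mul_card hs' hr' hF']
  exact h.sum_eq hc

end GassmannEquivalent

end FixedPoints

section RingHomOrbits

open Polynomial

theorem exists_apply_eq_apply_smul {B G Ω : Type*} [CommRing B] [Group G] [Finite G]
    [MulSemiringAction G B] [CommRing Ω] [IsDomain Ω] {y y' : B →+* Ω}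
    (h : ∀ b, (∀ g : G, g • b = b) → y b = y' b) (b : B) : ∃ g : G, y' b = y (g • b) := by
  have := Fintype.ofFinite G
  have hmap : (MulSemiringAction.charpoly G b).map y' = (MulSemiringAction.charpoly G b).map y := by
    ext i
    rw [coeff_map, coeff_map, h _ fun g ↦ MulSemiringAction.smul_coeff_charpoly b i g]
  have hroot : eval (y' b) ((MulSemiringAction.charpoly G b).map y) = 0 := by
    rw [← hmap, eval_map, eval₂_hom, MulSemiringAction.eval_charpoly, map_zero]
  rw [MulSemiringAction.charpoly_eq, Polynomial.map_prod, eval_prod, Finset.prod_eq_zero_iff]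
    at hroot
  obtain ⟨g, -, hg⟩ := hroot
  refine ⟨g, sub_eq_zero.1 ?_⟩
  rwa [Polynomial.map_sub, map_X, map_C, eval_sub, eval_X, eval_C] at hg

/-- A single `g` is found by applying `exists_apply_eq_apply_smul` to the polynomial over `B` whose
coefficients generate `B` (Kronecker's trick). -/
theorem exists_eq_comp_toRingHom {B G Ω : Type*} [CommRing B] [Module.Finite ℤ B] [Group G]
    [Finite G] [MulSemiringAction G B] [CommRing Ω] [IsDomain Ω] {y y' : B →+* Ω}
    (h : ∀ b, (∀ g : G, g • b = b) → y b = y' b) :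
    ∃ g : G, y' = y.comp (MulSemiringAction.toRingHom G B g) := by
  classical
  obtain ⟨n, s, hs⟩ := Module.Finite.exists_fin (R := ℤ) (M := B)
  obtain ⟨g, hg⟩ := exists_apply_eq_apply_smul (G := G) (y := mapRingHom y) (y' := mapRingHom y')
    (fun q hq ↦ by
      ext i
      simpa using h (q.coeff i) fun g ↦ congrArg (coeff · i) (hq g))
    (ofFn n s)
  have hgen (i : Fin n) : y' (s i) = y (g • s i) := by
    simpa [ofFn_coeff_eq_val_of_lt s i.2] using congrArg (coeff · i) hg
  refine ⟨g, RingHom.toIntAlgHom_injective (AlgHom.toLinearMap_injective ?_)⟩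
  refine LinearMap.ext_on_range (hs.trans rfl) hgen

/-- The action of a group on the homomorphisms out of a ring on which it acts. -/
@[reducible]
def ringHomMulAction (G B Ω : Type*) [Group G] [Semiring B] [Semiring Ω] [MulSemiringAction G B] :
    MulAction G (B →+* Ω) where
  smul g y := y.comp (MulSemiringAction.toRingHom G B g⁻¹)
  one_smul y := by
    ext x
    change y ((1 : G)⁻¹ • x) = y x
    rw [inv_one, one_smul]
  mul_smul g h y := by
    ext x
    change y ((g * h)⁻¹ • x) = y (h⁻¹ • g⁻¹ • x)
    rw [_root_.mul_inv_rev, mul_smul]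

theorem surjective_comp_algebraMap {A B Ω : Type*} [CommRing A] [CommRing B] [Algebra A B]
    [Algebra.IsIntegral A B] [FaithfulSMul A B] [Field Ω] [IsAlgClosed Ω] :
    Function.Surjective fun y : B →+* Ω ↦ y.comp (algebraMap A B) := by
  intro f
  have : (RingHom.ker f).IsPrime := RingHom.ker_isPrime f
  obtain ⟨Q, -, hQ, hQf⟩ := Ideal.exists_ideal_over_prime_of_isIntegral (RingHom.ker f)
    (⊥ : Ideal B) (by
      rw [← RingHom.ker_eq_comap_bot,
        (RingHom.injective_iff_ker_eq_bot _).1 (FaithfulSMul.algebraMap_injective A B)]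
      exact bot_le)
  have : Q.LiesOver (RingHom.ker f) := ⟨hQf.symm⟩
  let : Algebra (A ⧸ RingHom.ker f) Ω := (RingHom.kerLift f).toAlgebra
  have : FaithfulSMul (A ⧸ RingHom.ker f) Ω :=
    (faithfulSMul_iff_algebraMap_injective _ _).2 (RingHom.kerLift_injective f)
  have : Module.IsTorsionFree (A ⧸ RingHom.ker f) (B ⧸ Q) :=
    Module.isTorsionFree_iff_faithfulSMul.2 (Ideal.Quotient.instFaithfulSMul _ _)
  let y : B ⧸ Q →ₐ[A ⧸ RingHom.ker f] Ω := IsAlgClosed.lift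
  exact ⟨(y : B ⧸ Q →+* Ω).comp (Ideal.Quotient.mk Q),
    RingHom.ext fun a ↦ y.commutes (Ideal.Quotient.mk (RingHom.ker f) a)⟩

end RingHomOrbits

section RingOfIntegers

variable {M : Type*} [Field M] [NumberField M] [IsGalois ℚ M] {Ω : Type*}

theorem exists_algebraMap_eq_of_forall_smul_eq {K : IntermediateField ℚ M} {x : 𝓞 M}
    (hx : ∀ g : K.fixingSubgroup, g • x = x) : ∃ a : 𝓞 K, algebraMap (𝓞 K) (𝓞 M) a = x := by
  have hxK : (x : M) ∈ K := by
    rw [← IsGalois.fixedField_fixingSubgroup K, IntermediateField.mem_fixedField_iff]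
    exact fun g hg ↦ congrArg (algebraMap (𝓞 M) M) (hx ⟨g, hg⟩)
  have hxi : IsIntegral ℤ (⟨x, hxK⟩ : K) :=
    (isIntegral_algHom_iff (K.val.restrictScalars ℤ) K.val.injective).1 x.isIntegral_coe
  exact ⟨⟨⟨x, hxK⟩, hxi⟩, rfl⟩

theorem comp_algebraMap_eq_iff [CommRing Ω] [IsDomain Ω] {K : IntermediateField ℚ M}
    {y y' : 𝓞 M →+* Ω} :
    y.comp (algebraMap (𝓞 K) (𝓞 M)) = y'.comp (algebraMap (𝓞 K) (𝓞 M)) ↔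
      ∃ g : K.fixingSubgroup, y' = y.comp (MulSemiringAction.toRingHom _ _ g) := by
  constructor
  · refine fun h ↦ exists_eq_comp_toRingHom fun b hb ↦ ?_
    obtain ⟨a, rfl⟩ := exists_algebraMap_eq_of_forall_smul_eq hb
    exact RingHom.congr_fun h a
  · rintro ⟨g, rfl⟩
    refine RingHom.ext fun a ↦ congrArg y (NumberField.RingOfIntegers.ext ?_)
    exact ((IntermediateField.mem_fixingSubgroup_iff _ _).1 g.2 _ (a : K).2).symm

instance finite_ringOfIntegers_ringHom [CommRing Ω] [IsDomain Ω] : Finite (𝓞 M →+* Ω) := by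
  rcases isEmpty_or_nonempty (𝓞 M →+* Ω) with h | ⟨⟨y⟩⟩
  · infer_instance
  · refine Finite.of_surjective (fun g : Gal(M/ℚ) ↦ y.comp (MulSemiringAction.toRingHom _ _ g))
      fun y' ↦ ?_
    obtain ⟨g, hg⟩ := exists_eq_comp_toRingHom (G := Gal(M/ℚ)) (y := y) (y' := y') fun b hb ↦ by
      obtain ⟨a, rfl⟩ := Algebra.IsInvariant.isInvariant (A := ℤ) (G := Gal(M/ℚ)) b hb
      simp
    exact ⟨g, hg.symm⟩

theorem GassmannEquivalent.card_ringHom_eq {K L : IntermediateField ℚ M}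
    (h : GassmannEquivalent K.fixingSubgroup L.fixingSubgroup)
    [Field Ω] [IsAlgClosed Ω] (φ : Ω →+* Ω) :
    Nat.card {f : 𝓞 K →+* Ω // φ.comp f = f} = Nat.card {f : 𝓞 L →+* Ω // φ.comp f = f} := by
  let : MulAction Gal(M/ℚ) (𝓞 M →+* Ω) := ringHomMulAction _ _ _
  have horbit (E : IntermediateField ℚ M) (y y' : 𝓞 M →+* Ω) :
      y.comp (algebraMap (𝓞 E) (𝓞 M)) = y'.comp (algebraMap (𝓞 E) (𝓞 M)) ↔
        ∃ u : E.fixingSubgroup, u • y = y' := by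
    rw [comp_algebraMap_eq_iff, (Equiv.inv _).exists_congr_left]
    exact exists_congr fun u ↦ eq_comm
  exact h.card_fixedPoints_eq surjective_comp_algebraMap surjective_comp_algebraMap (horbit K)
    (horbit L) (F := φ.comp) (fun _ _ ↦ rfl) (fun _ ↦ rfl) (fun _ ↦ rfl)

end RingOfIntegers

section PrimeCounting

open IsDedekindDomain

variable {R : Type*} [CommRing R] {Ω : Type*}

theorem ker_ne_bot_of_charP [CharZero R] [Semiring Ω] {p : ℕ} (hp : p ≠ 0) [CharP Ω p]
    (f : R →+* Ω) : RingHom.ker f ≠ ⊥ := by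
  intro h
  have hp_mem : (p : R) ∈ RingHom.ker f := by
    rw [RingHom.mem_ker, map_natCast, CharP.cast_eq_zero]
  rw [h, Ideal.mem_bot, Nat.cast_eq_zero] at hp_mem
  exact hp hp_mem

theorem card_le_of_forall_pow_eq [IsDomain R] {m : ℕ} (hm : 1 < m) (h : ∀ x : R, x ^ m = x) :
    Nat.card R ≤ m := by
  classical
  rcases finite_or_infinite R with _ | _
  · have := Fintype.ofFinite R
    have hdeg : (Polynomial.X ^ m - Polynomial.X : Polynomial R).natDegree = m := by
      compute_degree!
      · simp [hm.ne]
      · exact hm.le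
    have hne : (Polynomial.X ^ m - Polynomial.X : Polynomial R) ≠ 0 :=
      Polynomial.ne_zero_of_natDegree_gt (n := 0) (by lia)
    rw [Nat.card_eq_fintype_card, ← Finset.card_univ]
    refine (Polynomial.card_le_degree_of_subset_roots fun x _ ↦ ?_).trans hdeg.le
    rw [Polynomial.mem_roots hne]
    simp [h x]
  · simp

/-- Homomorphisms into a field with a given maximal kernel are the same as homomorphisms out of the
residue field. -/
def ringHomKerEquiv [DivisionRing Ω] (I : Ideal R) [hI : I.IsMaximal] :
    {f : R →+* Ω // RingHom.ker f = I} ≃ (R ⧸ I →+* Ω) where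
  toFun f := Ideal.Quotient.lift I f.1 fun a ha ↦ by rwa [← f.2, RingHom.mem_ker] at ha
  invFun g := ⟨g.comp (Ideal.Quotient.mk I), by
    let := Ideal.Quotient.field I
    ext x
    rw [RingHom.mem_ker, RingHom.comp_apply, map_eq_zero, Ideal.Quotient.eq_zero_iff_mem]⟩
  left_inv _ := Subtype.ext (RingHom.ext fun _ ↦ rfl)
  right_inv _ := Ideal.Quotient.ringHom_ext (RingHom.ext fun _ ↦ rfl)

theorem comp_ringHomKerEquiv_eq_iff [DivisionRing Ω] {I : Ideal R} [I.IsMaximal]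
    {φ : Ω →+* Ω} {f : {f : R →+* Ω // RingHom.ker f = I}} :
    φ.comp f.1 = f ↔ φ.comp (ringHomKerEquiv I f) = ringHomKerEquiv I f :=
  ⟨fun h ↦ Ideal.Quotient.ringHom_ext h, fun h ↦ congrArg (·.comp (Ideal.Quotient.mk I)) h⟩

variable [IsDedekindDomain R] [Module.Free ℤ R]

/-- The nonzero prime ideals of norm `q`. -/
abbrev PrimesOfNorm (R : Type*) [CommRing R] [IsDedekindDomain R] [Module.Free ℤ R] (q : ℕ) :
    Type _ :=
  {P : HeightOneSpectrum R // P.asIdeal.absNorm = q}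

namespace PrimesOfNorm

instance [Module.Finite ℤ R] [CharZero R] (q : ℕ) : Finite (PrimesOfNorm R q) :=
  have := ((Ideal.finite_setOfPred_absNorm_eq (S := R) q)).to_subtype
  Finite.of_injective (fun P ↦ (⟨P.1.asIdeal, P.2⟩ : {I : Ideal R | I.absNorm = q}))
    fun _ _ h ↦ Subtype.ext (HeightOneSpectrum.ext (congrArg Subtype.val h))

instance : IsEmpty (PrimesOfNorm R 1) :=
  ⟨fun P ↦ P.1.isPrime.ne_top (Ideal.absNorm_eq_one_iff.1 P.2)⟩

theorem exists_eq_prime_pow [Module.Finite ℤ R] {q : ℕ} (P : PrimesOfNorm R q) :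
    ∃ p n, p.Prime ∧ q = p ^ n := by
  obtain ⟨p, n, -, -, hp, h⟩ := Ideal.exists_prime_and_absNorm_eq_pow P.1.asIdeal
  exact ⟨p, n, hp, P.2.symm.trans h⟩

variable {p : ℕ} [Fact p.Prime] {j : ℕ}

theorem nonempty_quotient_ringEquiv_galoisField (P : PrimesOfNorm R (p ^ j)) :
    Nonempty (R ⧸ P.1.asIdeal ≃+* GaloisField p j) := by
  have hp : p.Prime := Fact.out
  obtain ⟨P, hN⟩ := P
  have hj : j ≠ 0 := by
    rintro rfl
    exact P.isPrime.ne_top (Ideal.absNorm_eq_one_iff.1 hN)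
  have : Finite (R ⧸ P.asIdeal) :=
    (Ideal.absNorm_ne_zero_iff _).1 (hN ▸ pow_ne_zero _ hp.ne_zero)
  have := Fintype.ofFinite (R ⧸ P.asIdeal)
  have := Fintype.ofFinite (GaloisField p j)
  let := Ideal.Quotient.field P.asIdeal
  refine ⟨FiniteField.ringEquivOfCardEq ?_⟩
  rw [← Nat.card_eq_fintype_card, ← Nat.card_eq_fintype_card, GaloisField.card p j hj]
  exact hN

theorem nonempty_ringHom_ker_equiv [Field Ω] (φ : Ω →+* Ω) (P : PrimesOfNorm R (p ^ j)) :
    Nonempty ({f : {f : R →+* Ω // RingHom.ker f = P.1.asIdeal} // φ.comp f.1 = f} ≃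
      {g : GaloisField p j →+* Ω // φ.comp g = g}) := by
  obtain ⟨e⟩ := P.nonempty_quotient_ringEquiv_galoisField
  let c : {g : R ⧸ P.1.asIdeal →+* Ω // φ.comp g = g} ≃
      {g : GaloisField p j →+* Ω // φ.comp g = g} :=
    { toFun := fun g ↦ ⟨g.1.comp (e.symm : GaloisField p j →+* R ⧸ P.1.asIdeal),
        RingHom.ext fun x ↦ RingHom.congr_fun g.2 (e.symm x)⟩
      invFun := fun g ↦ ⟨g.1.comp (e : R ⧸ P.1.asIdeal →+* GaloisField p j),
        RingHom.ext fun x ↦ RingHom.congr_fun g.2 (e x)⟩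
      left_inv := fun g ↦ Subtype.ext (RingHom.ext fun x ↦ congrArg g.1 (e.symm_apply_apply x))
      right_inv := fun g ↦ Subtype.ext (RingHom.ext fun x ↦ congrArg g.1 (e.apply_symm_apply x)) }
  exact ⟨((ringHomKerEquiv _).subtypeEquiv fun _ ↦ comp_ringHomKerEquiv_eq_iff).trans c⟩

end PrimesOfNorm

variable [Field Ω] (p : ℕ) [Fact p.Prime]

theorem card_ringHom_absNorm_ker_eq (φ : Ω →+* Ω) (j : ℕ) :
    Nat.card {f : R →+* Ω // φ.comp f = f ∧ (RingHom.ker f).absNorm = p ^ j} =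
      Nat.card (PrimesOfNorm R (p ^ j)) *
        Nat.card {g : GaloisField p j →+* Ω // φ.comp g = g} := by
  have hbot (f : R →+* Ω) (hf : (RingHom.ker f).absNorm = p ^ j) : RingHom.ker f ≠ ⊥ := by
    intro h
    rw [h, Ideal.absNorm_bot] at hf
    exact pow_ne_zero j (Fact.out : p.Prime).ne_zero hf.symm
  let e : {f : R →+* Ω // φ.comp f = f ∧ (RingHom.ker f).absNorm = p ^ j} ≃
      Σ P : PrimesOfNorm R (p ^ j),
        {f : {f : R →+* Ω // RingHom.ker f = P.1.asIdeal} // φ.comp f.1 = f} :=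
    { toFun := fun f ↦ ⟨⟨⟨RingHom.ker f.1, RingHom.ker_isPrime f.1, hbot _ f.2.2⟩, f.2.2⟩,
        ⟨f.1, rfl⟩, f.2.1⟩
      invFun := fun a ↦ ⟨a.2.1, a.2.2, by rw [a.2.1.2, a.1.2]⟩
      left_inv := fun _ ↦ rfl
      right_inv := by
        rintro ⟨⟨⟨I, _, _⟩, _⟩, ⟨f, hf⟩, _⟩
        cases hf
        rfl }
  rw [← Nat.card_prod]
  exact Nat.card_congr (e.trans
    (Equiv.sigmaEquivProdOfEquiv fun P ↦ (P.nonempty_ringHom_ker_equiv φ).some))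

variable [CharP Ω p]

theorem exists_absNorm_ker_eq_pow [Module.Finite ℤ R] [CharZero R] {f : R →+* Ω} {n : ℕ}
    (hn : n ≠ 0) (hf : (iterateFrobenius Ω p n).comp f = f) :
    ∃ j ∈ Finset.range (n + 1), (RingHom.ker f).absNorm = p ^ j := by
  have hp : p.Prime := Fact.out
  have hprime : (RingHom.ker f).IsPrime := RingHom.ker_isPrime f
  have hmax : (RingHom.ker f).IsMaximal := hprime.isMaximal (ker_ne_bot_of_charP hp.ne_zero f)
  obtain ⟨p', j, -, hp'f, hp', hN⟩ := Ideal.exists_prime_and_absNorm_eq_pow (RingHom.ker f)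
  obtain rfl : p = p' := by
    rw [RingHom.mem_ker, map_natCast, CharP.cast_eq_zero_iff Ω p] at hp'f
    exact (Nat.prime_dvd_prime_iff_eq hp hp').1 hp'f
  have hpow (x : R ⧸ RingHom.ker f) : x ^ p ^ n = x := by
    obtain ⟨x, rfl⟩ := Ideal.Quotient.mk_surjective x
    refine RingHom.kerLift_injective f ?_
    rw [← map_pow]
    exact (map_pow f x _).trans (RingHom.congr_fun hf x)
  refine ⟨j, Finset.mem_range_succ_iff.2 ((Nat.pow_le_pow_iff_right hp.one_lt).1 ?_), hN⟩
  have hcard := card_le_of_forall_pow_eq (Nat.one_lt_pow hn hp.one_lt) hpow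
  exact hN.symm.trans_le hcard

theorem card_ringHom_eq_sum [Module.Finite ℤ R] [CharZero R] [Finite (R →+* Ω)] {n : ℕ}
    (hn : n ≠ 0) : Nat.card {f : R →+* Ω // (iterateFrobenius Ω p n).comp f = f} =
      ∑ j ∈ Finset.range (n + 1), Nat.card (PrimesOfNorm R (p ^ j)) *
        Nat.card {g : GaloisField p j →+* Ω // (iterateFrobenius Ω p n).comp g = g} := by
  classical
  have := Fintype.ofFinite (R →+* Ω)
  have hp : p.Prime := Fact.out
  simp_rw [← card_ringHom_absNorm_ker_eq]
  rw [Nat.card_eq_fintype_card, Fintype.card_subtype, Finset.card_eq_sum_card_fiberwise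
    (f := fun f ↦ (RingHom.ker f).absNorm) (t := (Finset.range (n + 1)).image (p ^ ·)),
    Finset.sum_image fun _ _ _ _ h ↦ Nat.pow_right_injective hp.two_le h]
  · refine Finset.sum_congr rfl fun j _ ↦ ?_
    rw [Nat.card_eq_fintype_card, Fintype.card_subtype, Finset.filter_filter]
  · intro f hf
    obtain ⟨j, hj, h⟩ := exists_absNorm_ker_eq_pow p hn (Finset.mem_filter.1 hf).2
    exact Finset.mem_coe.2 (Finset.mem_image.2 ⟨j, hj, h.symm⟩)

theorem nonempty_galoisField_ringHom [IsAlgClosed Ω] {n : ℕ} (hn : n ≠ 0) :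
    Nonempty {g : GaloisField p n →+* Ω // (iterateFrobenius Ω p n).comp g = g} := by
  let := ZMod.algebra Ω p
  let g : GaloisField p n →ₐ[ZMod p] Ω := IsAlgClosed.lift
  have := Fintype.ofFinite (GaloisField p n)
  refine ⟨g, RingHom.ext fun x ↦ ?_⟩
  have hx : x ^ p ^ n = x := by
    rw [← GaloisField.card p n hn, Nat.card_eq_fintype_card, FiniteField.pow_card]
  exact (map_pow g x _).symm.trans (congrArg g hx)

theorem finite_galoisField_ringHom (n : ℕ) : Finite (GaloisField p n →+* Ω) := by
  let := ZMod.algebra Ω p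
  refine Finite.of_injective (β := GaloisField p n →ₐ[ZMod p] Ω)
    (fun g ↦ { g with commutes' := RingHom.congr_fun (Subsingleton.elim
      (g.comp (algebraMap (ZMod p) _)) (algebraMap (ZMod p) Ω)) }) fun g g' h ↦ ?_
  exact RingHom.ext fun x ↦ DFunLike.congr_fun h x

theorem card_primesOfNorm_pow_eq [IsAlgClosed Ω] [Module.Finite ℤ R] [CharZero R]
    [Finite (R →+* Ω)] {S : Type*} [CommRing S] [IsDedekindDomain S] [Module.Free ℤ S]
    [Module.Finite ℤ S] [CharZero S] [Finite (S →+* Ω)]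
    (h : ∀ n, Nat.card {f : R →+* Ω // (iterateFrobenius Ω p n).comp f = f} =
      Nat.card {f : S →+* Ω // (iterateFrobenius Ω p n).comp f = f}) (n : ℕ) :
    Nat.card (PrimesOfNorm R (p ^ n)) = Nat.card (PrimesOfNorm S (p ^ n)) := by
  induction n using Nat.strong_induction_on with
  | _ n ih =>
    rcases eq_or_ne n 0 with rfl | hn
    · simp
    have hsum := h n
    rw [card_ringHom_eq_sum p hn, card_ringHom_eq_sum p hn, Finset.sum_range_succ,
      Finset.sum_range_succ, Finset.sum_congr rfl fun j hj ↦ by rw [ih j (Finset.mem_range.1 hj)]]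
      at hsum
    have := nonempty_galoisField_ringHom p (Ω := Ω) hn
    have := finite_galoisField_ringHom p (Ω := Ω) n
    exact Nat.eq_of_mul_eq_mul_right Nat.card_pos (Nat.add_left_cancel hsum)

end PrimeCounting

section IdealCounting

open IsDedekindDomain UniqueFactorizationMonoid

/-- Unique factorization of ideals: the nonzero ideals of a Dedekind domain correspond to the finite
multisets of nonzero primes. -/
noncomputable def nonzeroIdealEquivMultiset (R : Type*) [CommRing R] [IsDedekindDomain R] :
    {I : Ideal R // I ≠ ⊥} ≃ Multiset (HeightOneSpectrum R) where
  toFun I := (normalizedFactors I.1).attach.map fun P ↦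
    HeightOneSpectrum.ofPrime (prime_of_normalized_factor P.1 P.2)
  invFun s := ⟨(s.map HeightOneSpectrum.asIdeal).prod, by
    rw [← Ideal.zero_eq_bot, Ne, Multiset.prod_eq_zero_iff, Multiset.mem_map]
    rintro ⟨P, -, hP⟩
    exact P.ne_bot hP⟩
  left_inv I := Subtype.ext <| by
    simp only [Multiset.map_map, Function.comp_def, HeightOneSpectrum.ofPrime,
      Multiset.attach_map_val]
    exact associated_iff_eq.1 (prod_normalizedFactors I.2)
  right_inv s := by
    refine Multiset.map_injective HeightOneSpectrum.asIdeal_injective ?_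
    simp only [Multiset.map_map, Function.comp_def, HeightOneSpectrum.ofPrime,
      Multiset.attach_map_val]
    refine normalizedFactors_prod_of_prime fun P hP ↦ ?_
    obtain ⟨P, -, rfl⟩ := Multiset.mem_map.1 hP
    exact P.prime

variable {R S : Type*} [CommRing R] [IsDedekindDomain R] [Module.Free ℤ R] [CommRing S]
  [IsDedekindDomain S] [Module.Free ℤ S]

theorem exists_equiv_nonzeroIdeal_absNorm_eq
    (e : HeightOneSpectrum R ≃ HeightOneSpectrum S)
    (he : ∀ P, (e P).asIdeal.absNorm = P.asIdeal.absNorm) :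
    ∃ E : {I : Ideal R // I ≠ ⊥} ≃ {I : Ideal S // I ≠ ⊥},
      ∀ I, (E I).1.absNorm = I.1.absNorm := by
  let m : Multiset (HeightOneSpectrum R) ≃ Multiset (HeightOneSpectrum S) :=
    { toFun := Multiset.map e
      invFun := Multiset.map e.symm
      left_inv s := by simp
      right_inv s := by simp }
  refine ⟨(nonzeroIdealEquivMultiset R).trans (m.trans (nonzeroIdealEquivMultiset S).symm),
    fun I ↦ ?_⟩
  obtain ⟨s, rfl⟩ := (nonzeroIdealEquivMultiset R).symm.surjective I
  rw [Equiv.trans_apply, Equiv.apply_symm_apply]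
  change Ideal.absNorm ((s.map e).map HeightOneSpectrum.asIdeal).prod =
    Ideal.absNorm (s.map HeightOneSpectrum.asIdeal).prod
  simp only [map_multiset_prod, Multiset.map_map, Function.comp_def, he]

theorem card_ideal_absNorm_eq [Module.Finite ℤ R] [CharZero R] [Module.Finite ℤ S] [CharZero S]
    (h : ∀ q, Nat.card (PrimesOfNorm R q) = Nat.card (PrimesOfNorm S q)) {n : ℕ} (hn : n ≠ 0) :
    Nat.card {I : Ideal R // I.absNorm = n} = Nat.card {I : Ideal S // I.absNorm = n} := by
  let c (q : ℕ) : PrimesOfNorm R q ≃ PrimesOfNorm S q := (Finite.card_eq.1 (h q)).some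
  obtain ⟨E, hE⟩ := exists_equiv_nonzeroIdeal_absNorm_eq (Equiv.ofFiberEquiv c)
    (Equiv.ofFiberEquiv_map c)
  have hneR (I : Ideal R) (hI : I.absNorm = n) : I ≠ ⊥ := by
    rintro rfl
    exact hn (hI.symm.trans Ideal.absNorm_bot)
  have hneS (I : Ideal S) (hI : I.absNorm = n) : I ≠ ⊥ := by
    rintro rfl
    exact hn (hI.symm.trans Ideal.absNorm_bot)
  exact Nat.card_congr ((Equiv.subtypeSubtypeEquivSubtype (hneR _)).symm.trans
    ((E.subtypeEquiv fun I ↦ by rw [hE]).trans (Equiv.subtypeSubtypeEquivSubtype (hneS _))))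

theorem card_primesOfNorm_eq [Module.Finite ℤ R] [Module.Finite ℤ S]
    (h : ∀ p n : ℕ, p.Prime →
      Nat.card (PrimesOfNorm R (p ^ n)) = Nat.card (PrimesOfNorm S (p ^ n))) (q : ℕ) :
    Nat.card (PrimesOfNorm R q) = Nat.card (PrimesOfNorm S q) := by
  by_cases hq : ∃ p n : ℕ, p.Prime ∧ q = p ^ n
  · obtain ⟨p, n, hp, rfl⟩ := hq
    exact h p n hp
  · have : IsEmpty (PrimesOfNorm R q) := ⟨fun P ↦ hq P.exists_eq_prime_pow⟩
    have : IsEmpty (PrimesOfNorm S q) := ⟨fun P ↦ hq P.exists_eq_prime_pow⟩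
    rw [Nat.card_of_isEmpty, Nat.card_of_isEmpty]

theorem GassmannEquivalent.arithmeticallyEquivalent {M : Type*} [Field M] [NumberField M]
    [IsGalois ℚ M] {K L : IntermediateField ℚ M}
    (h : GassmannEquivalent K.fixingSubgroup L.fixingSubgroup) :
    NumberField.ArithmeticallyEquivalent K L := by
  have hprimes (q : ℕ) : Nat.card (PrimesOfNorm (𝓞 K) q) = Nat.card (PrimesOfNorm (𝓞 L) q) := by
    refine card_primesOfNorm_eq (fun p n hp ↦ ?_) q
    have : Fact p.Prime := ⟨hp⟩
    have (E : IntermediateField ℚ M) : Finite (𝓞 E →+* AlgebraicClosure (ZMod p)) :=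
      Finite.of_surjective _ (surjective_comp_algebraMap (B := 𝓞 M))
    exact card_primesOfNorm_pow_eq p (Ω := AlgebraicClosure (ZMod p))
      (fun n ↦ h.card_ringHom_eq (iterateFrobenius _ p n)) n
  funext s
  refine LSeries_congr (fun {n} hn ↦ ?_) s
  rw [card_ideal_absNorm_eq hprimes hn]

end IdealCounting

section FixedFields

theorem GassmannEquivalent.map_mulEquiv {G H : Type*} [Group G] [Group H] {U V : Subgroup G}
    (h : GassmannEquivalent U V) (e : G ≃* H) :
    GassmannEquivalent (U.map e.toMonoidHom) (V.map e.toMonoidHom) := by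
  intro C
  obtain ⟨a, rfl⟩ := ConjClasses.exists_rep C
  have himage (W : Subgroup G) : (ConjClasses.mk a).carrier ∩ (W.map e.toMonoidHom : Set H) =
      e '' ((ConjClasses.mk (e.symm a)).carrier ∩ (W : Set G)) := by
    ext x
    constructor
    · rintro ⟨hx, y, hy, rfl⟩
      refine ⟨y, ⟨?_, hy⟩, rfl⟩
      rw [ConjClasses.mem_carrier_iff_mk_eq, ConjClasses.mk_eq_mk_iff_isConj] at hx ⊢
      simpa using e.symm.toMonoidHom.map_isConj hx
    · rintro ⟨y, ⟨hy, hyW⟩, rfl⟩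
      refine ⟨?_, y, hyW, rfl⟩
      rw [ConjClasses.mem_carrier_iff_mk_eq, ConjClasses.mk_eq_mk_iff_isConj] at hy ⊢
      simpa using e.toMonoidHom.map_isConj hy
  rw [himage, himage, Set.ncard_image_of_injective _ e.injective,
    Set.ncard_image_of_injective _ e.injective]
  exact h _

variable {k M G : Type*} [Field k] [Field M] [Algebra k M] [FiniteDimensional k M] [Group G]

theorem fixingSubgroup_fixedField_comap (e : Gal(M/k) ≃* G) (U : Subgroup G) :
    (IntermediateField.fixedField (U.comap e.toMonoidHom)).fixingSubgroup =
      U.map e.symm.toMonoidHom := by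
  rw [IntermediateField.fixingSubgroup_fixedField]
  exact (Subgroup.map_equiv_eq_comap_symm e.symm U).symm

theorem subgroupsConjugate_map_mulEquiv_iff {H : Type*} [Group H] {U V : Subgroup G} (e : G ≃* H) :
    SubgroupsConjugate (U.map e.toMonoidHom) (V.map e.toMonoidHom) ↔ SubgroupsConjugate U V :=
  ⟨fun h ↦ by simpa [Subgroup.map_map] using h.map_mulEquiv e.symm, fun h ↦ h.map_mulEquiv e⟩

end FixedFields

theorem mainTheorem9 :
    (∀ (F : Type*) [Field F] [Finite F] (d : ℕ), 3 ≤ d →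
      ∀ ℓ W : Submodule F (Fin d → F), Module.finrank F ℓ = 1 → Module.finrank F W + 1 = d →
        -- the two stabilizers in `PSL_d(F)`
        (IsCoatom (pslStabilizer ℓ) ∧ IsCoatom (pslStabilizer W) ∧
          SylowConjugate (pslStabilizer ℓ) (pslStabilizer W) ∧
          ¬ SubgroupsConjugate (pslStabilizer ℓ) (pslStabilizer W) ∧
          (∃ φ : MulAut (Matrix.ProjectiveSpecialLinearGroup (Fin d) F),
            φ ∉ (MulAut.conj (G := Matrix.ProjectiveSpecialLinearGroup (Fin d) F)).range ∧
              (pslStabilizer ℓ).map φ.toMonoidHom = pslStabilizer W) ∧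
          GassmannEquivalent (pslStabilizer ℓ) (pslStabilizer W)) ∧
        -- their fixed fields, for every realization of `PSL_d(F)` as a Galois group over `ℚ`
        (∀ (M : Type*) [Field M] [NumberField M] [IsGalois ℚ M]
          (e : Gal(M/ℚ) ≃* Matrix.ProjectiveSpecialLinearGroup (Fin d) F)
          (K L : IntermediateField ℚ M),
          K = IntermediateField.fixedField ((pslStabilizer ℓ).comap e.toMonoidHom) →
          L = IntermediateField.fixedField ((pslStabilizer W).comap e.toMonoidHom) →
          NumberField.SylowConjugate K L ∧ NumberField.ArithmeticallyEquivalent K L ∧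
            IsEmpty (K ≃+* L))) ∧
    -- `PSL_3(2)` is a Galois group over `ℚ`
    (∃ (M : Type) (_ : Field M) (_ : NumberField M), IsGalois ℚ M ∧
      Nonempty (Gal(M/ℚ) ≃* Matrix.ProjectiveSpecialLinearGroup (Fin 3) (ZMod 2))) := by
  refine ⟨fun F _ _ d hd ℓ W hℓ hW ↦ ?_,
    exists_isGalois_rat_projectiveSpecialLinearGroup_three_two⟩
  have hconj : ¬ SubgroupsConjugate (pslStabilizer ℓ) (pslStabilizer W) := by
    obtain ⟨v, hv, rfl⟩ := exists_eq_span_singleton_of_finrank_eq_one hℓ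
    exact not_subgroupsConjugate_pslStabilizer hv (by lia)
  obtain ⟨v, hv, rfl⟩ := exists_eq_span_singleton_of_finrank_eq_one hℓ
  obtain ⟨w, hw, rfl⟩ := exists_eq_dotHyperplane hW
  have hsylow := sylowConjugate_pslStabilizer hv hw
  have hgassmann := gassmannEquivalent_pslStabilizer hv hw
  obtain ⟨φ, hφ⟩ := exists_mulAut_map_pslStabilizer_span_eq hv hw
  refine ⟨⟨isCoatom_pslStabilizer_span_singleton (by lia) hv,
    isCoatom_pslStabilizer_dotHyperplane (by lia) hw, hsylow, hconj, ⟨φ, ?_, hφ⟩, hgassmann⟩, ?_⟩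
  · rintro ⟨x, rfl⟩
    exact hconj ⟨x, hφ⟩
  · rintro M _ _ _ e _ _ rfl rfl
    have hfix := fixingSubgroup_fixedField_comap e
    exact ⟨numberField_sylowConjugate_of_fixingSubgroup (by simpa only [hfix] using hsylow.map _),
      GassmannEquivalent.arithmeticallyEquivalent
        (by simpa only [hfix] using hgassmann.map_mulEquiv e.symm),
      isEmpty_ringEquiv_of_not_subgroupsConjugate
        (by simpa only [hfix, subgroupsConjugate_map_mulEquiv_iff] using hconj)⟩
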